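/- Let $k$ be a field of characteristic $2$ and let $Q_8=\langle \epsilon,i,j \mid \epsilon^2=1,\ i^2=j^2=(ij)^2=\epsilon\rangle$ be the quaternion group of order $8$. Let $\mathrm{StMod}(kQ_8)$ be the stable module category (left $kQ_8$-modules, with module maps taken modulo those that factor through a projective module), with its standard triangulated structure; $\mathrm{stmod}(kQ_8)$ is its full subcategory of objects stably isomorphic to finitely generated modules, and $\mathrm{thick}\langle k\rangle$ is the smallest full triangulated subcategory that is closed under retracts and contains the trivial module $k$. A ghost is a map in $\mathrm{StMod}(kQ_8)$ that induces zero in Tate cohomology $\hat H^n(Q_8,-)$ for all $n\in\mathbb Z$; a double ghost in $\mathrm{stmod}(kQ_8)$ is a composite of two ghosts between objects of $\mathrm{stmod}(kQ_8)$. Let $V$ be the quotient of $Q_8$ by $\langle\epsilon\rangle$ (a Klein four group, generated by the images of $i$ and $j$, again written $i,j$), and view the rank one free $kV$-module $kV$ as a $kQ_8$-module through $Q_8\to V$. Then right multiplication by $(i+1)(j+1)$ on $kV$ is a double ghost in $\mathrm{stmod}(kQ_8)$ and is non-zero in $\mathrm{stmod}(kQ_8)$. Moreover $$3\le \text{ghost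 number of } kQ_8\le \text{generating number of } kQ_8\le 4 .$$ Here, the ghost number of $kQ_8$ is the least upper bound, over $M\in\mathrm{thick}\langle k\rangle$, of the smallest $n$ such that every $n$-fold composite of ghosts in $\mathrm{thick}\langle k\rangle$ with domain $M$ is zero in the stable category. The generating number of $kQ_8$ is the least upper bound, over $M\in\mathrm{thick}\langle k\rangle$, of the smallest $n$ with $M\in\mathcal F_n$, where $\mathcal F$ is the class of retracts of (arbitrary) direct sums of suspensions $\Sigma^m k$ ($m\in\mathbb Z$) in $\mathrm{StMod}(kQ_8)$, $\mathcal F_0$ consists of the zero objects, and $\mathcal F_{n}$ ($n\ge1$) consists of the retracts of objects $N$ that sit in a cofibre sequence $P\to N\to Q$ with $P\in\mathcal F$ and $Q\in\mathcal F_{n-1}$. -/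

import Mathlib

open CategoryTheory
open scoped MonoidAlgebra

universe u

namespace StableModule

/-! ### Tate cohomology of modules over a group algebra vanishes on projectives

These facts are what makes Tate cohomology a functor on the stable module category. -/

theorem contractNth_zero_cons {G : Type u} [Group G] {n : ℕ} (x : G) (g : Fin (n+1) → G) :
   Fin.contractNth 0 (· * ·) (Fin.cons x g : Fin (n+2) → G) = Fin.cons (x * g 0) (fun i => g i.succ) := by
  funext k
  refine Fin.cases ?_ (fun k => ?_) k
  · simp [Fin.contractNth]
  · simp [Fin.contractNth]
theorem contractNth_succ_cons {G : Type u} [Group G] {n : ℕ} (x : G) (g : Fin (n+1) → G) (j : Fin (n+1)):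
   Fin.contractNth j.succ (· * ·) (Fin.cons x g : Fin (n+2) → G) = Fin.cons x (Fin.contractNth j (· * ·) g) := by
  funext k
  refine Fin.cases ?_ (fun k => ?_) k
  · simp [Fin.contractNth]
  · simp [Fin.contractNth]

theorem cochain_exact {k G : Type u} [CommRing k] [Group G] [Fintype G] {M : Rep.{u} k G} (θ : M →ₗ[k] M)
    (hθ : ∀ m : M, ∑ x : G, M.ρ x (θ (M.ρ x⁻¹ m)) = m)
    (n : ℕ) (φ : (Fin (n + 1) → G) → M)
    (h : (inhomogeneousCochains.d M (n + 1)).hom φ = 0) :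
    ∃ ψ : (Fin n → G) → M, (inhomogeneousCochains.d M n).hom ψ = φ := by
  refine ⟨fun g => ∑ x : G, M.ρ x (θ (φ (Fin.cons x⁻¹ g))), ?_⟩
  funext g
  have key : ∀ x : G, M.ρ x (θ (M.ρ x⁻¹ (φ g))) = M.ρ x (θ (φ (Fin.cons (x⁻¹ * g 0) fun i => g i.succ)))
      + ∑ j : Fin (n + 1), (-1 : k) ^ ((j : ℕ) + 1) • M.ρ x (θ (φ (Fin.cons x⁻¹ (Fin.contractNth j (· * ·) g)))) := by
    intro x
    have h1 := congrFun h (Fin.cons x⁻¹ g)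
    rw [inhomogeneousCochains.d_hom_apply, Fin.sum_univ_succ] at h1
    simp only [contractNth_zero_cons, contractNth_succ_cons, Fin.cons_zero, Fin.cons_succ, Fin.val_zero, Fin.val_succ] at h1
    have h2 : M.ρ x⁻¹ (φ g) = φ (Fin.cons (x⁻¹ * g 0) fun i => g i.succ) +
      ∑ j : Fin (n + 1), (-1 : k) ^ ((j : ℕ) + 1) • (φ (Fin.cons x⁻¹ (Fin.contractNth j (· * ·) g))) := by
      rw [← sub_eq_zero, ← (show _ = (0 : M) from h1)]
      have e : ∀ (j : ℕ) (v : M), (-1 : k) ^ (j + 1 + 1) • v = -((-1 : k) ^ (j + 1) • v) := by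
        intro j v
        rw [pow_succ, mul_neg_one, neg_smul]
      simp only [e, Finset.sum_neg_distrib, zero_add, pow_one, neg_smul, one_smul]
      abel
    rw [h2]
    simp only [map_add, map_sum, map_smul]
  have shift : M.ρ (g 0) (∑ x : G, M.ρ x (θ (φ (Fin.cons x⁻¹ fun i => g i.succ)))) =
      ∑ x : G, M.ρ x (θ (φ (Fin.cons (x⁻¹ * g 0) fun i => g i.succ))) := by
    rw [map_sum]
    refine Fintype.sum_equiv (Equiv.mulLeft (g 0)) _ _ fun x => ?_
    simp [mul_assoc]
  rw [inhomogeneousCochains.d_hom_apply, shift]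
  conv_rhs => rw [← hθ (φ g)]
  simp only [key, Finset.sum_add_distrib, Finset.smul_sum]
  rw [Finset.sum_comm (s := Finset.univ (α := G))]

theorem chain_exact {k G : Type u} [CommRing k] [Group G] [Fintype G] {M : Rep.{u} k G} (θ : M →ₗ[k] M)
    (hθ : ∀ m : M, ∑ x : G, M.ρ x (θ (M.ρ x⁻¹ m)) = m)
    (n : ℕ) (c : (Fin (n + 1) → G) →₀ M)
    (h : (groupHomology.inhomogeneousChains.d M n).hom c = 0) :
    ∃ b : (Fin (n + 2) → G) →₀ M, (groupHomology.inhomogeneousChains.d M (n + 1)).hom b = c := by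
  let H (m : ℕ) : ((Fin m → G) →₀ M) →ₗ[k] ((Fin (m + 1) → G) →₀ M) :=
    Finsupp.lsum k fun g => ∑ x : G, Finsupp.lsingle (Fin.cons x g) ∘ₗ θ ∘ₗ M.ρ x
  have H1 (m : ℕ) (g : Fin m → G) (a : M) :
      H m (Finsupp.single g a) = ∑ x : G, Finsupp.single (Fin.cons x g) (θ (M.ρ x a)) := by
    simp [H]
  have key : ∀ c : (Fin (n + 1) → G) →₀ M,
      (groupHomology.inhomogeneousChains.d M (n + 1)).hom (H (n + 1) c) +
        H n ((groupHomology.inhomogeneousChains.d M n).hom c) = c := by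
    intro c
    induction c using Finsupp.induction_linear with
    | zero => simp
    | add a b ha hb =>
      conv_rhs => rw [← ha, ← hb]
      simp only [map_add]
      abel
    | single g a =>
      have D (m : ℕ) (g : Fin (m + 1) → G) (a : M) := groupHomology.inhomogeneousChains.d_single m g a
      have e : ∀ (j : ℕ) (v : (Fin (n + 1) → G) →₀ M), (-1 : k) ^ (j + 1 + 1) • v = -((-1 : k) ^ (j + 1) • v) := by
        intro j v
        rw [pow_succ, mul_neg_one, neg_smul]
      have L : (groupHomology.inhomogeneousChains.d M (n + 1)).hom (H (n + 1) (Finsupp.single g a)) =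
          Finsupp.single g a
          - ∑ x : G, Finsupp.single (Fin.cons (x * g 0) fun i => g i.succ : Fin (n + 1) → G) (θ (M.ρ x a))
          - ∑ x : G, ∑ j : Fin (n + 1), (-1 : k) ^ ((j : ℕ) + 1) •
              Finsupp.single (Fin.cons x (Fin.contractNth j (· * ·) g) : Fin (n + 1) → G) (θ (M.ρ x a)) := by
        rw [H1, map_sum]
        have : ∀ x : G, (groupHomology.inhomogeneousChains.d M (n + 1)).hom
            (Finsupp.single (Fin.cons x g) (θ (M.ρ x a))) =
            Finsupp.single g (M.ρ x⁻¹ (θ (M.ρ x a)))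
            - Finsupp.single (Fin.cons (x * g 0) fun i => g i.succ : Fin (n + 1) → G) (θ (M.ρ x a))
            - ∑ j : Fin (n + 1), (-1 : k) ^ ((j : ℕ) + 1) •
              Finsupp.single (Fin.cons x (Fin.contractNth j (· * ·) g) : Fin (n + 1) → G) (θ (M.ρ x a)) := by
          intro x
          refine (D (n + 1) (Fin.cons x g) _).trans ?_
          rw [Fin.sum_univ_succ]
          simp only [contractNth_zero_cons, contractNth_succ_cons, Fin.cons_zero, Fin.cons_succ,
            Fin.val_zero, Fin.val_succ, e, Finset.sum_neg_distrib, zero_add, pow_one, neg_smul, one_smul]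
          abel
        simp only [this, Finset.sum_sub_distrib]
        congr 2
        conv_rhs => rw [← hθ a]
        rw [← Finsupp.single_finsetSum]
        congr 1
        exact Fintype.sum_equiv (Equiv.inv G) _ _ fun x => by simp
      have R : H n ((groupHomology.inhomogeneousChains.d M n).hom (Finsupp.single g a)) =
          ∑ x : G, Finsupp.single (Fin.cons (x * g 0) fun i => g i.succ : Fin (n + 1) → G) (θ (M.ρ x a))
          + ∑ x : G, ∑ j : Fin (n + 1), (-1 : k) ^ ((j : ℕ) + 1) •
              Finsupp.single (Fin.cons x (Fin.contractNth j (· * ·) g) : Fin (n + 1) → G) (θ (M.ρ x a)) := by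
        refine (congrArg (H n) (D n g a)).trans ?_
        simp only [map_add, map_sum, map_smul, H1, Finset.smul_sum]
        congr 1
        · refine Fintype.sum_equiv (Equiv.mulRight (g 0)⁻¹) _ _ fun x => ?_
          simp
        · exact Finset.sum_comm
      rw [L, R]
      abel
  refine ⟨H (n + 1) c, ?_⟩
  have := key c
  rwa [h, map_zero, add_zero] at this

theorem tateNorm_exact_right {k G : Type u} [CommRing k] [Group G] [Fintype G] {M : Rep.{u} k G} (θ : M →ₗ[k] M)
    (hθ : ∀ m : M, ∑ x : G, M.ρ x (θ (M.ρ x⁻¹ m)) = m)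
    (φ : (Fin 0 → G) → M)
    (h : (inhomogeneousCochains.d M 0).hom φ = 0) :
    ∃ c : (Fin 0 → G) →₀ M, M.tateNorm.hom c = φ := by
  have hinv : ∀ x : G, M.ρ x (φ default) = φ default := by
    intro x
    have h1 := congrFun h (fun _ => x)
    rw [inhomogeneousCochains.d_hom_apply] at h1
    rw [Fin.sum_univ_one] at h1
    simp only [Fin.val_zero, zero_add, pow_one, neg_smul, one_smul] at h1
    have h2 := sub_eq_zero.1 ((sub_eq_add_neg _ _).trans h1)
    have e : (fun _ : Fin 0 => x) = default := Subsingleton.elim _ _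
    rw [Subsingleton.elim (Fin.contractNth 0 (fun x1 x2 => x1 * x2) fun _ : Fin 1 => x) default, e] at h2
    exact h2
  refine ⟨Finsupp.single default (θ (φ default)), ?_⟩
  rw [Rep.tateNorm_eq]
  funext g
  rw [Subsingleton.elim g default]
  have := hθ (φ default)
  simp only [hinv] at this
  simpa [Representation.norm] using this

theorem tateNorm_exact_left {k G : Type u} [CommRing k] [Group G] [Fintype G] {M : Rep.{u} k G} (θ : M →ₗ[k] M)
    (hθ : ∀ m : M, ∑ x : G, M.ρ x (θ (M.ρ x⁻¹ m)) = m)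
    (c : (Fin 0 → G) →₀ M) (h : M.tateNorm.hom c = 0) :
    ∃ b : (Fin 1 → G) →₀ M, (groupHomology.inhomogeneousChains.d M 0).hom b = c := by
  obtain ⟨m, rfl⟩ : ∃ m, c = Finsupp.single default m :=
    ⟨c default, Finsupp.ext fun i => by rw [Subsingleton.elim i default]; simp⟩
  have hm : ∑ x : G, M.ρ x m = 0 := by
    rw [Rep.tateNorm_eq] at h
    have := congrFun h default
    simpa [Representation.norm] using! this
  refine ⟨∑ x : G, Finsupp.single (fun _ => x) (θ (M.ρ x m)), ?_⟩
  rw [map_sum]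
  have D (x : G) (a : M) : (groupHomology.inhomogeneousChains.d M 0).hom
      (Finsupp.single (fun _ => x) a) =
      Finsupp.single default (M.ρ x⁻¹ a) - Finsupp.single default a := by
    refine (groupHomology.inhomogeneousChains.d_single 0 (fun _ => x) a).trans ?_
    simp [sub_eq_add_neg, Subsingleton.elim _ (default : Fin 0 → G)]
  simp only [D, Finset.sum_sub_distrib, ← Finsupp.single_finsetSum]
  rw [← map_sum, hm, map_zero, Finsupp.single_zero, sub_zero]
  congr 1
  conv_rhs => rw [← hθ m]
  exact Fintype.sum_equiv (Equiv.inv G) _ _ fun x => by simp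

theorem tateComplex_exactAt {k G : Type u} [CommRing k] [Group G] [Fintype G] {M : Rep.{u} k G} (θ : M →ₗ[k] M)
    (hθ : ∀ m : M, ∑ x : G, M.ρ x (θ (M.ρ x⁻¹ m)) = m)
    (n : ℤ) : (tateComplex M).ExactAt n := by
  rw [HomologicalComplex.exactAt_iff' _ (n - 1) n (n + 1) (by simp) (by simp),
    ShortComplex.moduleCat_exact_iff]
  change ∀ x, ((tateComplex M).d n (n + 1)).hom x = 0 → ∃ y, ((tateComplex M).d (n - 1) n).hom y = x
  obtain (_ | n) | (_ | n) := n
  · intro x hx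
    refine tateNorm_exact_right θ hθ x ?_
    rw [← groupCohomology.inhomogeneousCochains.d_def]
    exact hx
  · intro x hx
    obtain ⟨y, hy⟩ := cochain_exact θ hθ n x (by
      rw [← groupCohomology.inhomogeneousCochains.d_def]
      exact hx)
    rw [← groupCohomology.inhomogeneousCochains.d_def] at hy
    have e : (Int.ofNat (n + 1) - 1 : ℤ) = Int.ofNat n := by simp
    rw [e]
    exact ⟨y, hy⟩
  · intro x hx
    obtain ⟨y, hy⟩ := tateNorm_exact_left θ hθ x hx
    rw [← groupHomology.inhomogeneousChains.d_def] at hy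
    exact ⟨y, hy⟩
  · intro x hx
    have e : (Int.negSucc (n + 1) + 1 : ℤ) = Int.negSucc n := rfl
    have e' : (Int.negSucc (n + 1) - 1 : ℤ) = Int.negSucc (n + 2) := rfl
    rw [e] at hx
    rw [e']
    have hx' : ((groupHomology.inhomogeneousChains M).d (n + 1) n).hom x = 0 := hx
    rw [groupHomology.inhomogeneousChains.d_def] at hx'
    obtain ⟨y, hy⟩ := chain_exact θ hθ n x hx'
    rw [← groupHomology.inhomogeneousChains.d_def] at hy
    exact ⟨y, hy⟩

theorem isZero_tate {k G : Type u} [CommRing k] [Group G] [Fintype G] {M : Rep.{u} k G} (θ : M →ₗ[k] M)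
    (hθ : ∀ m : M, ∑ x : G, M.ρ x (θ (M.ρ x⁻¹ m)) = m)
    (n : ℤ) : Limits.IsZero ((tateCohomologyFunctor n).obj M) :=
  (tateComplex_exactAt θ hθ n).isZero_homology

/-- Tate cohomology `Ĥⁿ(G, -)` of modules over the group algebra. -/
noncomputable def moduleTate (k G : Type u) [CommRing k] [Group G] [Fintype G] (n : ℤ) :
    ModuleCat.{u} k[G] ⥤ ModuleCat.{u} k :=
  Rep.ofModuleMonoidAlgebra ⋙ tateCohomologyFunctor n

theorem moduleTate_map_add {k G : Type u} [CommRing k] [Group G] [Fintype G] (n : ℤ)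
    {M N : ModuleCat.{u} k[G]} (f g : M ⟶ N) :
    (moduleTate k G n).map (f + g) = (moduleTate k G n).map f + (moduleTate k G n).map g := by
  have : (tateCohomologyFunctor (R := k) (G := G) n).Additive := by
    unfold tateCohomologyFunctor; infer_instance
  exact (tateCohomologyFunctor (R := k) (G := G) n).map_add
    (f := Rep.ofModuleMonoidAlgebra.map f) (g := Rep.ofModuleMonoidAlgebra.map g)

theorem exists_trace_id {k G : Type u} [CommRing k] [Group G] [Fintype G]
    (X : Type u) [AddCommGroup X] [Module k X] [Module k[G] X]
    [IsScalarTower k k[G] X] [Module.Projective k[G] X] : ∃ θ : X →ₗ[k] X,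
    ∀ m, ∑ x : G, MonoidAlgebra.of k G x • θ (MonoidAlgebra.of k G x⁻¹ • m) = m := by
  obtain ⟨s, hs⟩ := ‹Module.Projective k[G] X›.out
  let θ' : (X →₀ k[G]) →ₗ[k] X := Finsupp.lsum k fun p =>
    LinearMap.toSpanSingleton k X p ∘ₗ Finsupp.lapply 1 ∘ₗ (MonoidAlgebra.coeffLinearEquiv k).toLinearMap
  have key : ∀ w : X →₀ k[G], ∑ x : G, MonoidAlgebra.of k G x • θ' (MonoidAlgebra.of k G x⁻¹ • w) =
      Finsupp.linearCombination k[G] (id : X → X) w := by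
    intro w
    induction w using Finsupp.induction_linear with
    | zero => simp
    | add a b ha hb => simp only [smul_add, map_add, Finset.sum_add_distrib, ha, hb]
    | single p r =>
      induction r using MonoidAlgebra.induction_linear with
      | zero => simp
      | add a b ha hb => simp only [Finsupp.single_add, smul_add, map_add, Finset.sum_add_distrib, ha, hb]
      | single y a =>
        classical
        have e (x : G) : θ' (MonoidAlgebra.of k G x⁻¹ • Finsupp.single p (MonoidAlgebra.single y a)) =
            if x = y then a • p else 0 := by
          simp [θ', MonoidAlgebra.single_mul_single, Finsupp.single_apply, inv_mul_eq_one]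
        simp only [e, Finsupp.linearCombination_single, id]
        rw [Finset.sum_eq_single y (fun x _ hx => by simp [hx]) (by simp), if_pos rfl,
          ← smul_one_smul k[G] a p, smul_smul]
        congr 1
        simp [MonoidAlgebra.one_def, MonoidAlgebra.single_mul_single]
  refine ⟨θ' ∘ₗ s.restrictScalars k, fun m => ?_⟩
  have := key (s m)
  rw [hs m] at this
  simpa using this

theorem isZero_moduleTate {k G : Type u} [CommRing k] [Group G] [Fintype G]
    (n : ℤ) (P : ModuleCat.{u} k[G]) [Projective P] :
    Limits.IsZero ((moduleTate k G n).obj P) := by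
  have hP : Module.Projective k[G] P := (IsProjective.iff_projective P).2 inferInstance
  let _ : Module k P := Module.compHom P (algebraMap k k[G])
  have : IsScalarTower k k[G] P := ⟨fun a b c => by
    change (a • b) • c = (algebraMap k k[G] a) • (b • c)
    rw [smul_smul, Algebra.smul_def]⟩
  obtain ⟨θ, hθ⟩ := exists_trace_id (k := k) (G := G) P
  exact isZero_tate (M := Rep.ofModuleMonoidAlgebra.obj P) θ hθ n

/-! ### The stable module category -/

/-- A map of `k[G]`-modules is stably trivial if it factors through a projective module. -/
def StablyTrivial {k G : Type u} [Field k] [Group G] {M N : ModuleCat.{u} k[G]}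
    (f : M ⟶ N) : Prop :=
  ∃ (P : ModuleCat.{u} k[G]) (_ : Projective P) (g : M ⟶ P) (h : P ⟶ N), g ≫ h = f

theorem StablyTrivial.add {k G : Type u} [Field k] [Group G] {M N : ModuleCat.{u} k[G]}
    {f f' : M ⟶ N} (hf : StablyTrivial f) (hf' : StablyTrivial f') : StablyTrivial (f + f') := by
  obtain ⟨P, _, g, h, rfl⟩ := hf
  obtain ⟨P', _, g', h', rfl⟩ := hf'
  exact ⟨P ⊞ P', inferInstance, Limits.biprod.lift g g', Limits.biprod.desc h h', by simp⟩

theorem StablyTrivial.neg {k G : Type u} [Field k] [Group G] {M N : ModuleCat.{u} k[G]}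
    {f : M ⟶ N} (hf : StablyTrivial f) : StablyTrivial (-f) := by
  obtain ⟨P, hP, g, h, rfl⟩ := hf
  exact ⟨P, hP, g, -h, by simp⟩

/-- Two maps are identified in the stable category if their difference is stably trivial. -/
def stableRel (k G : Type u) [Field k] [Group G] : HomRel (ModuleCat.{u} k[G]) :=
  fun _ _ f g => StablyTrivial (f - g)

instance stableRel_congruence (k G : Type u) [Field k] [Group G] :
    Congruence (stableRel k G) where
  equivalence :=
    { refl := fun f => ⟨ModuleCat.of k[G] PUnit,
        (ModuleCat.isZero_of_subsingleton (ModuleCat.of k[G] PUnit)).projective, 0, 0, by simp⟩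
      symm := fun {f g} h => by
        have := StablyTrivial.neg h
        rwa [neg_sub] at this
      trans := fun {f g h} h₁ h₂ => by
        have := StablyTrivial.add h₁ h₂
        rwa [sub_add_sub_cancel] at this }
  comp_left := by
    rintro X Y Z f g g' ⟨P, hP, a, b, h⟩
    exact ⟨P, hP, f ≫ a, b, by rw [Category.assoc, h, Preadditive.comp_sub]⟩
  comp_right := by
    rintro X Y Z f f' g ⟨P, hP, a, b, h⟩
    exact ⟨P, hP, a, b ≫ g, by rw [← Category.assoc, h, Preadditive.sub_comp]⟩

/-- The stable module category `StMod(kG)`: all left `k[G]`-modules, with maps taken modulo those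
that factor through a projective. -/
abbrev StMod (k G : Type u) [Field k] [Group G] :=
  CategoryTheory.Quotient (stableRel k G)

noncomputable instance StMod.preadditive (k G : Type u) [Field k] [Group G] :
    Preadditive (StMod k G) :=
  CategoryTheory.Quotient.preadditive (stableRel k G) fun _ _ f₁ f₂ g₁ g₂ h₁ h₂ => by
    have := StablyTrivial.add h₁ h₂
    rwa [sub_add_sub_comm] at this

/-- The projection functor `Mod(kG) ⥤ StMod(kG)`. -/
noncomputable abbrev toStMod (k G : Type u) [Field k] [Group G] : ModuleCat.{u} k[G] ⥤ StMod k G :=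
  CategoryTheory.Quotient.functor (stableRel k G)

/-- The objects of `stmod(kG)`: those stably isomorphic to a finitely generated module. -/
def stmod (k G : Type u) [Field k] [Group G] : ObjectProperty (StMod k G) :=
  fun X => ∃ M : ModuleCat.{u} k[G], Module.Finite k[G] M ∧ Nonempty (X ≅ (toStMod k G).obj M)

/-! ### Ghosts -/

theorem moduleTate_map_eq {k G : Type u} [Field k] [Group G] [Fintype G] (n : ℤ)
    (M N : ModuleCat.{u} k[G]) (f g : M ⟶ N) (h : stableRel k G f g) :
    (moduleTate k G n).map f = (moduleTate k G n).map g := by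
  obtain ⟨P, hP, a, b, h⟩ := h
  have e : f = a ≫ b + g := by rw [h, sub_add_cancel]
  rw [e, moduleTate_map_add, Functor.map_comp, (isZero_moduleTate n P).eq_of_tgt ((moduleTate k G n).map a) 0,
    Limits.zero_comp, zero_add]

/-- Tate cohomology `Ĥⁿ(G, -)` as a functor on the stable module category. -/
noncomputable def tateFunctor (k G : Type u) [Field k] [Group G] [Fintype G] (n : ℤ) :
    StMod k G ⥤ ModuleCat.{u} k :=
  CategoryTheory.Quotient.lift (stableRel k G) (moduleTate k G n) fun M N f g h => moduleTate_map_eq n M N f g h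

/-- A ghost is a map in the stable module category that induces zero in Tate cohomology. -/
def IsGhost {k G : Type u} [Field k] [Group G] [Fintype G] {X Y : StMod k G} (f : X ⟶ Y) : Prop :=
  ∀ n : ℤ, (tateFunctor k G n).map f = 0

/-- `GhostPower S n f`: the map `f` is an `n`-fold composite of ghosts in the full subcategory on
the objects satisfying `S`; for `n = 0` this is any map of that subcategory. (The ghosts form an
ideal, so for `n = 1` these are exactly the ghosts between objects of `S`.) -/
inductive GhostPower {k G : Type u} [Field k] [Group G] [Fintype G]
    (S : ObjectProperty (StMod k G)) : ℕ → {X Y : StMod k G} → (X ⟶ Y) → Prop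
  | zero {X Y : StMod k G} (hX : S X) (hY : S Y) (f : X ⟶ Y) : GhostPower S 0 f
  | succ {n : ℕ} {X Y Z : StMod k G} (hX : S X) (f : X ⟶ Y) (g : Y ⟶ Z) (hf : IsGhost f)
      (hg : GhostPower S n g) : GhostPower S (n + 1) (f ≫ g)

/-! ### Suspensions, cofibre sequences and the thick subcategory generated by `k` -/

/-- `Ω M`, the kernel of a surjection from a projective module onto `M`. -/
noncomputable def loop {k G : Type u} [Field k] [Group G] (M : ModuleCat.{u} k[G]) :
    ModuleCat.{u} k[G] :=
  Limits.kernel (Projective.π M)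

/-- `Σ M = Ω⁻¹ M`, the cokernel of an injection of `M` into an injective module. -/
noncomputable def susp {k G : Type u} [Field k] [Group G] (M : ModuleCat.{u} k[G]) :
    ModuleCat.{u} k[G] :=
  Limits.cokernel (Injective.ι M)

/-- The iterated suspension `Σⁿ M = Ω⁻ⁿ M`, for `n : ℤ`. -/
noncomputable def suspPow {k G : Type u} [Field k] [Group G] :
    ℤ → ModuleCat.{u} k[G] → ModuleCat.{u} k[G]
  | Int.ofNat n, M => susp^[n] M
  | Int.negSucc n, M => loop^[n + 1] M

/-- The trivial module `k`. -/
noncomputable def trivialModule (k G : Type u) [Field k] [Group G] : ModuleCat.{u} k[G] :=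
  ModuleCat.of k[G] (Representation.trivial k G k).asModule

/-- `X ⟶ Y ⟶ Z` is a cofibre sequence, i.e. the first two maps of a distinguished triangle of the
stable module category of a finite group: these are the sequences that are isomorphic in the stable
category to the image of a short exact sequence of modules. -/
def IsCofibreSequence {k G : Type u} [Field k] [Group G] {X Y Z : StMod k G}
    (f : X ⟶ Y) (g : Y ⟶ Z) : Prop :=
  ∃ (S : ShortComplex (ModuleCat.{u} k[G])) (_ : S.ShortExact)
    (a : X ≅ (toStMod k G).obj S.X₁) (b : Y ≅ (toStMod k G).obj S.X₂)
    (c : Z ≅ (toStMod k G).obj S.X₃),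
    f ≫ b.hom = a.hom ≫ (toStMod k G).map S.f ∧ g ≫ c.hom = b.hom ≫ (toStMod k G).map S.g

/-- A full triangulated subcategory closed under retracts. Closure under suspension and
desuspension is the case of a cofibre sequence whose middle term is zero. -/
structure IsThick {k G : Type u} [Field k] [Group G] (S : ObjectProperty (StMod k G)) : Prop where
  zero : ∀ X, Limits.IsZero X → S X
  retract : ∀ X Y, Nonempty (Retract X Y) → S Y → S X
  third : ∀ (X Y Z : StMod k G) (f : X ⟶ Y) (g : Y ⟶ Z), IsCofibreSequence f g → S X → S Y → S Z
  second : ∀ (X Y Z : StMod k G) (f : X ⟶ Y) (g : Y ⟶ Z), IsCofibreSequence f g → S X → S Z → S Y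
  first : ∀ (X Y Z : StMod k G) (f : X ⟶ Y) (g : Y ⟶ Z), IsCofibreSequence f g → S Y → S Z → S X

/-- The thick subcategory of `StMod(kG)` generated by the trivial module `k`. -/
def thickTrivial (k G : Type u) [Field k] [Group G] : ObjectProperty (StMod k G) :=
  fun X => ∀ S : ObjectProperty (StMod k G), IsThick S →
    S ((toStMod k G).obj (trivialModule k G)) → S X

/-! ### Generating number and ghost number -/

/-- The class `𝓕` of retracts of direct sums of suspensions `Σⁿ k`, `n : ℤ`. -/
def GhostProjective {k G : Type u} [Field k] [Group G] (X : StMod k G) : Prop :=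
  ∃ (ι : Type u) (d : ι → ℤ), Nonempty (Retract X ((toStMod k G).obj
    (ModuleCat.of k[G] (DirectSum ι fun i => suspPow (d i) (trivialModule k G)))))

/-- The classes `𝓕ₙ`: `𝓕₀` consists of the zero objects, and `𝓕ₙ₊₁` of the retracts of objects `M`
in a cofibre sequence `P ⟶ M ⟶ Q` with `P` in `𝓕` and `Q` in `𝓕ₙ`. -/
def GhostProjectivePow {k G : Type u} [Field k] [Group G] : ℕ → StMod k G → Prop
  | 0, X => Limits.IsZero X
  | n + 1, X => ∃ (P M Q : StMod k G) (f : P ⟶ M) (g : M ⟶ Q), IsCofibreSequence f g ∧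
      GhostProjective P ∧ GhostProjectivePow n Q ∧ Nonempty (Retract X M)

/-- The generating length: the smallest `n` with `X ∈ 𝓕ₙ` (`⊤` if there is none). -/
noncomputable def generatingLength {k G : Type u} [Field k] [Group G] (X : StMod k G) : ℕ∞ :=
  ⨅ (n : ℕ) (_ : GhostProjectivePow n X), (n : ℕ∞)

/-- The ghost length: the smallest `n` such that every `n`-fold composite of ghosts in `thick k`
with domain `X` is zero in the stable category (`⊤` if there is none). -/
noncomputable def ghostLength {k G : Type u} [Field k] [Group G] [Fintype G]
    (X : StMod k G) : ℕ∞ :=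
  ⨅ (n : ℕ) (_ : ∀ (Y : StMod k G) (f : X ⟶ Y), GhostPower (thickTrivial k G) n f → f = 0), (n : ℕ∞)

/-- The generating number of `kG`: the least upper bound of the generating lengths of the objects
of `thick k`. -/
noncomputable def generatingNumber (k G : Type u) [Field k] [Group G] : ℕ∞ :=
  ⨆ (X : StMod k G) (_ : thickTrivial k G X), generatingLength X

/-- The ghost number of `kG`: the least upper bound of the ghost lengths of the objects of
`thick k`. -/
noncomputable def ghostNumber (k G : Type u) [Field k] [Group G] [Fintype G] : ℕ∞ :=
  ⨆ (X : StMod k G) (_ : thickTrivial k G X), ghostLength X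

/-! ### The regular module of a quotient group, viewed as a `k[G]`-module -/

/-- For `N` normal in `G` and `V = G ⧸ N`, the rank one free module `k[V]`, viewed as a
`k[G]`-module through the quotient map `G → V`. -/
noncomputable def quotientRegular (k : Type u) {G : Type u} [Field k] [Group G] (N : Subgroup G)
    [N.Normal] : ModuleCat.{u} k[G] :=
  (ModuleCat.restrictScalars (MonoidAlgebra.mapDomainRingHom k (QuotientGroup.mk' N))).obj
    (ModuleCat.of k[G ⧸ N] k[G ⧸ N])

/-- Right multiplication `x ↦ x * v` on `k[V]`, a map of left `k[G]`-modules. -/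
noncomputable def rightMul (k : Type u) {G : Type u} [Field k] [Group G] (N : Subgroup G)
    [N.Normal] (v : k[G ⧸ N]) : quotientRegular k N ⟶ quotientRegular k N :=
  (ModuleCat.restrictScalars (MonoidAlgebra.mapDomainRingHom k (QuotientGroup.mk' N))).map
    (ModuleCat.ofHom (LinearMap.toSpanSingleton k[G ⧸ N] k[G ⧸ N] v))

end StableModule

open StableModule

/-! Everything rests on one criterion: a map of `k[G]`-modules is stably trivial exactly when it is
a trace `∑ x θ x⁻¹` of a `k`-linear map `θ` (`stablyTrivial_iff`). It also gives that projective and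
injective modules coincide, so stable maps can be shifted along short exact sequences with
projective middle term.

Ghost number at most generating number: a map `k ⟶ M` picks an invariant element, and a ghost sends
it to a norm, because `Ĥ⁰` is invariants modulo norms; hence the composite is a trace
(`isGhostTest_trivialModule`). Dimension shifting carries this to every `Σᵈ k`, and it passes to
sums and retracts. Along a cofibre sequence `P ⟶ M ⟶ Q` with `P` in `𝓕`, the first ghost kills `P`,
so it factors through `Q`, which the remaining ghosts kill by induction
(`GhostProjectivePow.comp_eq_zero`).

Lower bound: there is a short exact sequence `0 → kV → kG → kV → 0`, and right multiplication by `x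
+ 1` acts on all three terms compatibly. The connecting isomorphisms of Tate cohomology therefore
relate the effect of this map on `kV` in degrees `n` and `n + 1`, and in degree `0` it is zero since
`x` fixes the invariants and `V` is commutative (`moduleTate_rightMul_eq_zero`). So `i + 1` and `j +
1` give ghosts. Their composite is stably nonzero: `ε` acts trivially on `kV`, so in characteristic
`2` the terms of a trace cancel in pairs and every trace on `kV` vanishes
(`rightMul_eq_zero_of_stablyTrivial`), while `(i + 1)(j + 1) ≠ 0`.

Upper bound: each product of four factors `i + 1` or `j + 1` is `0` or the norm element `N`
(`words_quat_subset`). Stably, every module is a retract of one killed by `N`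
(`exists_free_splitting`). On such a module the words of length four vanish, and taking invariants
four times filters it by trivial modules, that is, by sums of copies of `k`
(`IsKilled.ghostProjectivePow`). -/

namespace StableModule

/-! ### Traces of `k`-linear maps -/

section Trace

variable {k G : Type u} [Field k] [Group G] [Fintype G]
  {X Y Z : Type u} [AddCommGroup X] [Module k X] [Module k[G] X] [IsScalarTower k k[G] X]
  [AddCommGroup Y] [Module k Y] [Module k[G] Y] [IsScalarTower k k[G] Y]
  [AddCommGroup Z] [Module k Z] [Module k[G] Z] [IsScalarTower k k[G] Z]

/-- A map of `k[G]`-modules from a `k`-linear map commuting with the group elements. -/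
def equivariantMap (f : X →ₗ[k] Y)
    (hf : ∀ (g : G) (m : X), f (MonoidAlgebra.of k G g • m) = MonoidAlgebra.of k G g • f m) :
    X →ₗ[k[G]] Y where
  toFun := f
  map_add' := map_add f
  map_smul' r m := by
    induction r using MonoidAlgebra.induction_on with
    | of g => exact hf g m
    | add a b ha hb => simp only [add_smul, map_add, ha, hb, RingHom.id_apply] at *
    | smul r a ha => simp only [smul_assoc, map_smul, ha, RingHom.id_apply] at *

/-- The trace `m ↦ ∑ x, x θ (x⁻¹ m)` of a `k`-linear map. -/
noncomputable def traceMap (θ : X →ₗ[k] Y) : X →ₗ[k[G]] Y :=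
  equivariantMap
    { toFun := fun m => ∑ x : G, MonoidAlgebra.of k G x • θ (MonoidAlgebra.of k G x⁻¹ • m)
      map_add' := fun a b => by simp only [smul_add, map_add, Finset.sum_add_distrib]
      map_smul' := fun r m => by
        simp only [smul_algebra_smul_comm, map_smul, Finset.smul_sum, RingHom.id_apply] }
    fun g m => by
      simp only [LinearMap.coe_mk, AddHom.coe_mk, Finset.smul_sum]
      refine Fintype.sum_equiv (Equiv.mulLeft g⁻¹) _ _ fun x => ?_
      simp only [Equiv.coe_mulLeft, mul_inv_rev, inv_inv, smul_smul, ← map_mul, mul_inv_cancel_left]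

theorem traceMap_apply (θ : X →ₗ[k] Y) (m : X) : traceMap (G := G) θ m =
    ∑ x : G, MonoidAlgebra.of k G x • θ (MonoidAlgebra.of k G x⁻¹ • m) := rfl

theorem comp_traceMap (f : Y →ₗ[k[G]] Z) (θ : X →ₗ[k] Y) :
    f ∘ₗ traceMap θ = traceMap (f.restrictScalars k ∘ₗ θ) := by
  ext m
  simp [traceMap_apply]

theorem traceMap_comp (θ : Y →ₗ[k] Z) (f : X →ₗ[k[G]] Y) :
    traceMap θ ∘ₗ f = traceMap (θ ∘ₗ f.restrictScalars k) := by
  ext m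
  simp [traceMap_apply]

theorem exists_traceMap_eq_id [Module.Projective k[G] X] :
    ∃ θ : X →ₗ[k] X, traceMap (G := G) θ = LinearMap.id := by
  obtain ⟨θ, hθ⟩ := exists_trace_id (k := k) (G := G) X
  exact ⟨θ, LinearMap.ext hθ⟩

/-- The coordinates of a `k[G]`-module in a `k`-basis, as elements of a free `k[G]`-module. -/
noncomputable def basisToFree {ι : Type u} (b : Module.Basis ι k X) : X →ₗ[k] (ι →₀ k[G]) :=
  Finsupp.mapRange.linearMap (Algebra.linearMap k k[G]) ∘ₗ b.repr.toLinearMap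

/-- The coefficient of `1` in each coordinate of the trace comes only from the term `x = 1`, so it
recovers the coordinates of `m`. This embeds any module in a free one. -/
theorem traceMap_basisToFree_injective {ι : Type u} (b : Module.Basis ι k X) :
    Function.Injective (traceMap (G := G) (basisToFree (G := G) b)) := by
  classical
  refine (injective_iff_map_eq_zero _).2 fun m hm => ?_
  refine b.repr.map_eq_zero_iff.1 (Finsupp.ext fun t => ?_)
  have h := congrArg (fun r : k[G] => r.coeff 1) (DFunLike.congr_fun hm t)
  simp only [traceMap_apply, basisToFree, Finsupp.finsetSum_apply, MonoidAlgebra.coeff_sum] at h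
  rw [Finset.sum_eq_single 1] at h
  · simpa [← MonoidAlgebra.one_def] using! h
  · intro x _ hx
    simp [MonoidAlgebra.single_mul_single, hx]
  · simp

/-- The map `θ` itself factors as the `k`-linear coordinate map into a free module followed by the
`k[G]`-linear map sending the generator `t` to `θ (b t)`; taking traces makes the first factor
equivariant. -/
theorem exists_comp_eq_traceMap (θ : X →ₗ[k] Y) : ∃ (ι : Type u) (f : X →ₗ[k[G]] (ι →₀ k[G]))
    (g : (ι →₀ k[G]) →ₗ[k[G]] Y), g ∘ₗ f = traceMap θ := by
  let b := Module.Basis.ofVectorSpace k X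
  refine ⟨_, traceMap (basisToFree b), Finsupp.linearCombination k[G] fun t => θ (b t), ?_⟩
  rw [comp_traceMap]
  congr 1
  refine b.ext fun t => ?_
  simp [basisToFree, ← MonoidAlgebra.one_def]

end Trace

/-! ### Stably trivial maps are traces; projective equals injective -/

theorem stablyTrivial_traceMap {k G : Type u} [Field k] [Group G] [Fintype G]
    {X Y : Type u} [AddCommGroup X] [Module k X] [Module k[G] X] [IsScalarTower k k[G] X]
    [AddCommGroup Y] [Module k Y] [Module k[G] Y] [IsScalarTower k k[G] Y] (θ : X →ₗ[k] Y) :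
    StablyTrivial (ModuleCat.ofHom (traceMap (G := G) θ)) := by
  obtain ⟨ι, a, b, h⟩ := exists_comp_eq_traceMap (G := G) θ
  refine ⟨ModuleCat.of k[G] (ι →₀ k[G]),
    (IsProjective.iff_projective (ι →₀ k[G])).1 inferInstance, ModuleCat.ofHom a,
    ModuleCat.ofHom b, ?_⟩
  rw [← h]
  rfl

open ModuleCat

variable {k G : Type u} [Field k] [Group G] [Fintype G]

/-- Higman's criterion: the identity of a projective module is a trace, and traces form an ideal;
conversely a trace factors through a free module. -/
theorem stablyTrivial_iff {M N : ModuleCat.{u} k[G]} (f : M ⟶ N) :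
    StablyTrivial f ↔ ∃ θ : M →ₗ[k] N, traceMap θ = f.hom := by
  constructor
  · rintro ⟨P, hP, g, h, rfl⟩
    have : Module.Projective k[G] P := (IsProjective.iff_projective P).2 hP
    obtain ⟨θ, hθ⟩ := exists_traceMap_eq_id (k := k) (G := G) (X := P)
    refine ⟨h.hom.restrictScalars k ∘ₗ θ ∘ₗ g.hom.restrictScalars k, ?_⟩
    rw [← comp_traceMap, ← traceMap_comp, hθ, LinearMap.id_comp, ModuleCat.hom_comp]
  · rintro ⟨θ, hθ⟩
    have := stablyTrivial_traceMap (G := G) θ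
    rwa [hθ] at this

/-- A monomorphism has a `k`-linear retraction `r`. Extending `g` by `g ∘ r` is not equivariant, but
inserting the `θ` whose trace is the identity of `P` and averaging repairs this without changing the
restriction. -/
theorem injective_of_projective (P : ModuleCat.{u} k[G]) [hP : Projective P] : Injective P := by
  have : Module.Projective k[G] P := (IsProjective.iff_projective P).2 hP
  obtain ⟨θ, hθ⟩ := exists_traceMap_eq_id (k := k) (G := G) (X := P)
  refine ⟨fun {X Y} g f hf => ?_⟩
  have hf' : Function.Injective (f.hom.restrictScalars k) := (ModuleCat.mono_iff_injective f).1 hf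
  obtain ⟨r, hr⟩ := (f.hom.restrictScalars k).exists_leftInverse_of_injective
    (LinearMap.ker_eq_bot.2 hf')
  refine ⟨ofHom (traceMap (θ ∘ₗ g.hom.restrictScalars k ∘ₗ r)), ?_⟩
  ext1
  rw [ModuleCat.hom_comp, ModuleCat.hom_ofHom, traceMap_comp, LinearMap.comp_assoc,
    LinearMap.comp_assoc, hr, LinearMap.comp_id, ← traceMap_comp, hθ, LinearMap.id_comp]

theorem projective_of_injective (P : ModuleCat.{u} k[G]) [Injective P] : Projective P := by
  let b := Module.Basis.ofVectorSpace k P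
  let F := ModuleCat.of k[G] (Module.Basis.ofVectorSpaceIndex k P →₀ k[G])
  have : Projective F := (IsProjective.iff_projective F).1 inferInstance
  let s : P ⟶ F := ofHom (traceMap (basisToFree b))
  have : Mono s := (ModuleCat.mono_iff_injective s).2 (traceMap_basisToFree_injective b)
  exact (Retract.mk s (Injective.factorThru (𝟙 P) s) (by simp)).projective


variable {k G : Type u} [Field k] [Group G]

theorem cochain_d_zero_iff {M : Rep.{u} k G} (φ : (Fin 0 → G) → M) :
    (inhomogeneousCochains.d M 0).hom φ = 0 ↔ ∀ x : G, M.ρ x (φ default) = φ default := by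
  have key (g : Fin 1 → G) : (inhomogeneousCochains.d M 0).hom φ g =
      M.ρ (g 0) (φ default) - φ default := by
    rw [inhomogeneousCochains.d_hom_apply, Fin.sum_univ_one]
    simp only [Fin.val_zero, zero_add, pow_one, neg_smul, one_smul]
    rw [sub_eq_add_neg, Subsingleton.elim (fun i : Fin 0 => g i.succ) default,
      Subsingleton.elim (Fin.contractNth 0 (fun x1 x2 => x1 * x2) g) default]
  constructor
  · intro h x
    have := congrFun h (fun _ => x)
    rw [key] at this
    exact sub_eq_zero.1 this
  · intro h
    funext g
    rw [key, h, sub_self]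
    rfl

/-! ### Morphisms of short exact sequences with projective middle terms -/

/-- Lift the factorisation of `τ₃` to the middle term of `T` and subtract it from `τ₂`: the
difference lands in the kernel of `T.g`, so it factors `τ₁` through the projective `S.X₂`. -/
theorem stablyTrivial_τ₁ {S T : ShortComplex (ModuleCat.{u} k[G])} (hT : T.ShortExact)
    (φ : S ⟶ T) (hS : Projective S.X₂) (h : StablyTrivial φ.τ₃) : StablyTrivial φ.τ₁ := by
  obtain ⟨Q, hQ, a, b, hab⟩ := h
  have := hT.mono_f
  have := hT.epi_g
  let c : Q ⟶ T.X₂ := Projective.factorThru b T.g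
  have hc : c ≫ T.g = b := Projective.factorThru_comp b T.g
  have h0 : (φ.τ₂ - S.g ≫ a ≫ c) ≫ T.g = 0 := by
    rw [Preadditive.sub_comp, φ.comm₂₃, Category.assoc, Category.assoc, hc, hab, sub_self]
  refine ⟨S.X₂, hS, S.f, hT.exact.lift _ h0, ?_⟩
  rw [← cancel_mono T.f, Category.assoc, hT.exact.lift_f, Preadditive.comp_sub, φ.comm₁₂]
  simp

theorem exists_hom_τ₃ {S T : ShortComplex (ModuleCat.{u} k[G])} (hT : T.ShortExact)
    (hS : Projective S.X₂) (u : S.X₃ ⟶ T.X₃) : ∃ φ : S ⟶ T, φ.τ₃ = u := by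
  have := hT.mono_f
  have := hT.epi_g
  let c : S.X₂ ⟶ T.X₂ := Projective.factorThru (S.g ≫ u) T.g
  have hc : c ≫ T.g = S.g ≫ u := Projective.factorThru_comp _ T.g
  exact ⟨{ τ₁ := hT.exact.lift (S.f ≫ c) (by simp [hc]), τ₂ := c, τ₃ := u
           comm₁₂ := hT.exact.lift_f _ _, comm₂₃ := hc }, rfl⟩

theorem exists_hom_τ₁ {S T : ShortComplex (ModuleCat.{u} k[G])} (hS : S.ShortExact)
    (hT : Injective T.X₂) (u : S.X₁ ⟶ T.X₁) : ∃ φ : S ⟶ T, φ.τ₁ = u := by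
  have := hS.mono_f
  have := hS.epi_g
  let c : S.X₂ ⟶ T.X₂ := Injective.factorThru (u ≫ T.f) S.f
  have hc : S.f ≫ c = u ≫ T.f := Injective.comp_factorThru _ S.f
  exact ⟨{ τ₁ := u, τ₂ := c, τ₃ := hS.exact.desc (c ≫ T.g) (by simp [reassoc_of% hc])
           comm₁₂ := hc.symm, comm₂₃ := (hS.exact.g_desc _ _).symm }, rfl⟩

variable [Fintype G]

theorem stablyTrivial_τ₃ {S T : ShortComplex (ModuleCat.{u} k[G])} (hS : S.ShortExact)
    (φ : S ⟶ T) (hT : Projective T.X₂) (h : StablyTrivial φ.τ₁) : StablyTrivial φ.τ₃ := by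
  obtain ⟨Q, hQ, a, b, hab⟩ := h
  have := injective_of_projective Q
  have := hS.mono_f
  have := hS.epi_g
  let c : S.X₂ ⟶ Q := Injective.factorThru a S.f
  have hc : S.f ≫ c = a := Injective.comp_factorThru a S.f
  have h0 : S.f ≫ (φ.τ₂ - c ≫ b ≫ T.f) = 0 := by
    rw [Preadditive.comp_sub, ← φ.comm₁₂, reassoc_of% hc, reassoc_of% hab, sub_self]
  refine ⟨T.X₂, hT, hS.exact.desc _ h0, T.g, ?_⟩
  rw [← cancel_epi S.g, hS.exact.g_desc_assoc, Preadditive.sub_comp, φ.comm₂₃]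
  simp

/-- Projective middle terms have no Tate cohomology, so both connecting maps are isomorphisms, and
they are natural in the sequence. -/
theorem moduleTate_map_τ_iff {S T : ShortComplex (ModuleCat.{u} k[G])} (hS : S.ShortExact)
    (hT : T.ShortExact) (φ : S ⟶ T) (hS' : Projective S.X₂) (hT' : Projective T.X₂) (n : ℤ) :
    (moduleTate k G n).map φ.τ₃ = 0 ↔ (moduleTate k G (n + 1)).map φ.τ₁ = 0 := by
  let F : ModuleCat.{u} k[G] ⥤ Rep.{u} k G := Rep.ofModuleMonoidAlgebra
  have hFS : (S.map F).ShortExact := hS.map_of_exact F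
  have hFT : (T.map F).ShortExact := hT.map_of_exact F
  have hiS : IsIso (TateCohomology.δ hFS n) :=
    (TateCohomology.map_tateComplexFunctor_shortExact hFS).isIso_δ n (n + 1) rfl
      (isZero_moduleTate n S.X₂) (isZero_moduleTate (n + 1) S.X₂)
  have hiT : IsIso (TateCohomology.δ hFT n) :=
    (TateCohomology.map_tateComplexFunctor_shortExact hFT).isIso_δ n (n + 1) rfl
      (isZero_moduleTate n T.X₂) (isZero_moduleTate (n + 1) T.X₂)
  let ψ : S.map F ⟶ T.map F := F.mapShortComplex.map φ
  have key : TateCohomology.δ hFS n ≫ (tateCohomologyFunctor (n + 1)).map ψ.τ₁ =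
      (tateCohomologyFunctor n).map ψ.τ₃ ≫ TateCohomology.δ hFT n :=
    TateCohomology.δ_naturality hFS hFT ψ n
  change (tateCohomologyFunctor n).map ψ.τ₃ = 0 ↔ (tateCohomologyFunctor (n + 1)).map ψ.τ₁ = 0
  constructor
  · intro h
    rw [h, Limits.zero_comp] at key
    rwa [← cancel_epi (TateCohomology.δ hFS n), Limits.comp_zero]
  · intro h
    rw [h, Limits.comp_zero] at key
    rw [← cancel_mono (TateCohomology.δ hFT n), Limits.zero_comp]
    exact key.symm

/-! ### Tate cohomology in degree zero -/

theorem tateNorm_single_apply (V : Rep.{u} k G) (v : V) :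
    V.tateNorm.hom (Finsupp.single default v) default = ∑ x : G, V.ρ x v := by
  rw [Rep.tateNorm_eq]
  simp [Representation.norm]

theorem tate_zero_map_eq_zero {M N : ModuleCat.{u} k[G]} (f : M ⟶ N)
    (hf : ∀ m : M, (∀ x : G, MonoidAlgebra.of k G x • m = m) → f.hom m = 0) :
    (moduleTate k G 0).map f = 0 := by
  let F : Rep.ofModuleMonoidAlgebra.obj M ⟶ Rep.ofModuleMonoidAlgebra.obj N :=
    Rep.ofModuleMonoidAlgebra.map f
  change HomologicalComplex.homologyMap (tateComplex.map F) 0 = 0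
  have h : HomologicalComplex.cyclesMap (tateComplex.map F) 0 = 0 := by
    rw [← cancel_mono (HomologicalComplex.iCycles _ 0), HomologicalComplex.cyclesMap_i,
      Limits.zero_comp]
    ext1
    refine LinearMap.ext fun y => ?_
    have h1 : (inhomogeneousCochains.d _ 0).hom
        (((tateComplex (Rep.ofModuleMonoidAlgebra.obj M)).iCycles 0).hom y) = 0 := by
      rw [← groupCohomology.inhomogeneousCochains.d_def]
      exact congrArg (fun t => t.hom y)
        ((tateComplex (Rep.ofModuleMonoidAlgebra.obj M)).iCycles_d 0 1)
    funext g
    rw [Subsingleton.elim g default]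
    exact hf _ ((cochain_d_zero_iff _).1 h1)
  rw [← cancel_epi (HomologicalComplex.homologyπ _ 0), HomologicalComplex.homologyπ_naturality, h,
    Limits.zero_comp, Limits.comp_zero]

/-- An invariant `m` is a cycle in degree `0`. Its image has zero class, so it is a boundary, and
the differential from degree `-1` to degree `0` is the norm. -/
theorem exists_norm_of_tate_zero_map {M N : ModuleCat.{u} k[G]} (f : M ⟶ N)
    (hf : (moduleTate k G 0).map f = 0) (m : M) (hm : ∀ x : G, MonoidAlgebra.of k G x • m = m) :
    ∃ n : N, f.hom m = ∑ x : G, MonoidAlgebra.of k G x • n := by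
  let F : Rep.ofModuleMonoidAlgebra.obj M ⟶ Rep.ofModuleMonoidAlgebra.obj N :=
    Rep.ofModuleMonoidAlgebra.map f
  let K := tateComplex (Rep.ofModuleMonoidAlgebra.obj M)
  let L := tateComplex (Rep.ofModuleMonoidAlgebra.obj N)
  change HomologicalComplex.homologyMap (tateComplex.map F) 0 = 0 at hf
  -- The element `m` is encoded as a map from `k`, so that the universal property of cycles applies.
  let t : ModuleCat.of k k ⟶ K.X 0 := ModuleCat.ofHom
    (LinearMap.toSpanSingleton k ((Fin 0 → G) → Rep.ofModuleMonoidAlgebra.obj M) fun _ => m)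
  have h2 : t.hom (1 : k) = fun _ => m := one_smul _ _
  have ht : t ≫ K.d 0 1 = 0 := by
    ext1
    refine LinearMap.ext_ring ?_
    have h1 : (inhomogeneousCochains.d (Rep.ofModuleMonoidAlgebra.obj M) 0).hom (fun _ => m) = 0 :=
      (cochain_d_zero_iff _).2 hm
    rw [← groupCohomology.inhomogeneousCochains.d_def] at h1
    have h2 : t.hom (1 : k) = fun _ => m := one_smul _ _
    change (K.d 0 1).hom (t.hom (1 : k)) = 0
    rw [h2]
    exact h1
  have ht' : (t ≫ (tateComplex.map F).f 0) ≫ L.d 0 1 = 0 := by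
    rw [Category.assoc, (tateComplex.map F).comm, reassoc_of% ht, Limits.zero_comp]
  have hz : L.liftCycles (t ≫ (tateComplex.map F).f 0) 1 (by simp) ht' ≫ L.homologyπ 0 = 0 := by
    have := K.liftCycles t 1 (by simp) ht ≫= (HomologicalComplex.homologyπ_naturality
      (tateComplex.map F) 0)
    rw [hf, Limits.comp_zero, Limits.comp_zero] at this
    rw [this, ← Category.assoc]
    congr 1
    rw [← cancel_mono (L.iCycles 0)]
    simp [L]
  have hex : (ShortComplex.mk (L.toCycles (-1) 0) (L.homologyπ 0) (by simp)).Exact :=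
    ShortComplex.exact_of_g_is_cokernel _ (L.homologyIsCokernel (-1) 0 (by simp))
  rw [ShortComplex.moduleCat_exact_iff] at hex
  obtain ⟨w, hw⟩ := hex ((L.liftCycles _ 1 _ ht').hom (1 : k)) (congrArg (fun t : ModuleCat.of k k ⟶ _ => t.hom (1 : k)) hz)
  have hw' := congrArg (L.iCycles 0).hom hw
  have h3 : (L.d (-1) 0).hom w = ((tateComplex.map F).f 0).hom (t.hom (1 : k)) := by
    have e1 := congrArg (fun t => t.hom w) (L.toCycles_i (-1) 0)
    refine e1.symm.trans (hw'.trans ?_)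
    exact congrArg (fun t : ModuleCat.of k k ⟶ _ => t.hom (1 : k)) (L.liftCycles_i _ 1 _ _)
  obtain ⟨n, rfl⟩ : ∃ n : Rep.ofModuleMonoidAlgebra.obj N, w = (Finsupp.single default n :
      (Fin 0 → G) →₀ Rep.ofModuleMonoidAlgebra.obj N) :=
    ⟨(show (Fin 0 → G) →₀ Rep.ofModuleMonoidAlgebra.obj N from w) default,
      Finsupp.ext fun i => by rw [Subsingleton.elim i default]; simp⟩
  refine ⟨n, ?_⟩
  rw [h2] at h3
  exact (congrFun h3 default).symm.trans (tateNorm_single_apply _ n)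


variable {k G : Type u} [Field k] [Group G]

/-! ### The quotient functor to the stable category -/

instance toStMod_additive : (toStMod k G).Additive where
  map_add := rfl

theorem toStMod_map_eq_zero_iff {M N : ModuleCat.{u} k[G]} (f : M ⟶ N) :
    (toStMod k G).map f = 0 ↔ StablyTrivial f := by
  rw [← (toStMod k G).map_zero M N, Quotient.functor_map_eq_iff (stableRel k G)]
  change StablyTrivial (f - 0) ↔ _
  rw [sub_zero]

theorem stablyTrivial_directSum {ι : Type u} {M : ι → ModuleCat.{u} k[G]} {N : ModuleCat.{u} k[G]}
    (f : ModuleCat.of k[G] (DirectSum ι fun i => M i) ⟶ N)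
    (hf : ∀ i (u : M i ⟶ N), (∀ m : M i, u.hom m = f.hom (letI := Classical.decEq ι;
      DirectSum.lof k[G] ι (fun i => M i) i m)) → StablyTrivial u) : StablyTrivial f := by
  classical
  have h (i : ι) : StablyTrivial (ModuleCat.ofHom (f.hom ∘ₗ DirectSum.lof k[G] ι (fun i => M i) i) :
      M i ⟶ N) := hf i _ fun m => by
    simp only [ModuleCat.hom_ofHom, LinearMap.comp_apply]
  choose P hP a b hab using h
  have (i : ι) : Module.Projective k[G] (P i) := (IsProjective.iff_projective (P i)).2 (hP i)
  refine ⟨ModuleCat.of k[G] (DirectSum ι fun i => P i),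
    (IsProjective.iff_projective (DirectSum ι fun i => P i)).1 inferInstance,
    ModuleCat.ofHom (DirectSum.lmap fun i => (a i).hom),
    ModuleCat.ofHom (DirectSum.toModule k[G] ι N fun i => (b i).hom), ?_⟩
  ext1
  refine DirectSum.linearMap_ext _ fun i => LinearMap.ext fun m => ?_
  have := congrArg (fun t => t.hom m) (hab i)
  simpa [DirectSum.lmap_lof] using! this

/-! ### Ghosts vanish on suspensions of the trivial module -/

theorem loop_shortExact (M : ModuleCat.{u} k[G]) :
    (ShortComplex.kernelSequence (Projective.π M)).ShortExact where
  exact := ShortComplex.kernelSequence_exact _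
  epi_g := inferInstanceAs (Epi (Projective.π M))

theorem susp_shortExact (M : ModuleCat.{u} k[G]) :
    (ShortComplex.cokernelSequence (Injective.ι M)).ShortExact where
  exact := ShortComplex.cokernelSequence_exact _
  mono_f := inferInstanceAs (Mono (Injective.ι M))

theorem of_smul_trivialModule (x : G) (c : trivialModule k G) : MonoidAlgebra.of k G x • c = c := by
  refine (Representation.single_smul (Representation.trivial k G k) 1 x c).trans ?_
  simp
  rfl

open ModuleCat in
/-- The trivial module is one-dimensional. -/
noncomputable def trivialModuleEquiv (k G : Type u) [Field k] [Group G] :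
    trivialModule k G ≃ₗ[k] k where
  toFun := (Representation.trivial k G k).asModuleEquiv
  invFun := (Representation.trivial k G k).asModuleEquiv.symm
  left_inv := (Representation.trivial k G k).asModuleEquiv.left_inv
  right_inv := (Representation.trivial k G k).asModuleEquiv.right_inv
  map_add' := map_add (Representation.trivial k G k).asModuleEquiv
  map_smul' r c := by
    refine (Representation.asModuleEquiv_map_smul (Representation.trivial k G k)
      (algebraMap k k[G] r) c).trans ?_
    simp

variable [Fintype G]

/-- Every map out of `A` becomes stably trivial after composition with a ghost. -/
def IsGhostTest (A : ModuleCat.{u} k[G]) : Prop :=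
  ∀ (M N : ModuleCat.{u} k[G]) (f : M ⟶ N), (∀ n, (moduleTate k G n).map f = 0) →
    ∀ u : A ⟶ M, StablyTrivial (u ≫ f)

-- The element `u 1` is invariant, so the ghost sends it to the norm of some `n`, and `u ≫ f` is the
-- trace of the `k`-linear map `1 ↦ n`.
open ModuleCat in
theorem isGhostTest_trivialModule : IsGhostTest (trivialModule k G) := by
  intro M N f hf u
  let e := trivialModuleEquiv k G
  obtain ⟨n, hn⟩ := exists_norm_of_tate_zero_map f (hf 0) (u.hom (e.symm 1)) fun x => by
    rw [← map_smul, of_smul_trivialModule]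
  refine (stablyTrivial_iff _).2 ⟨LinearMap.toSpanSingleton k N n ∘ₗ e.toLinearMap, ?_⟩
  refine LinearMap.ext fun c => ?_
  obtain ⟨r, rfl⟩ := e.symm.surjective c
  rw [← mul_one r, ← smul_eq_mul, map_smul, ← algebraMap_smul k[G] r (e.symm 1), map_smul, map_smul,
    ModuleCat.hom_comp, LinearMap.comp_apply, hn, traceMap_apply]
  simp only [of_smul_trivialModule, LinearMap.comp_apply, LinearEquiv.coe_coe,
    LinearEquiv.apply_symm_apply, LinearMap.toSpanSingleton_apply, one_smul]

/-- Maps `Σ A ⟶ M ⟶ N` shift to `A ⟶ Ω M ⟶ Ω N`; the shifted second map is again zero in Tate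
cohomology, since only the degree moves by one. Triviality of the shifted composite then shifts
back. -/
theorem IsGhostTest.susp {A : ModuleCat.{u} k[G]} (hA : IsGhostTest A) : IsGhostTest (susp A) := by
  intro M N f hf u
  let S := ShortComplex.cokernelSequence (Injective.ι A)
  have hS₂ : Projective S.X₂ := projective_of_injective (Injective.under A)
  have hM₂ : Projective (ShortComplex.kernelSequence (Projective.π M)).X₂ :=
    inferInstanceAs (Projective (Projective.over M))
  have hN₂ : Projective (ShortComplex.kernelSequence (Projective.π N)).X₂ :=
    inferInstanceAs (Projective (Projective.over N))
  obtain ⟨φ, hφ⟩ := exists_hom_τ₃ (loop_shortExact M) hS₂ (S := S) u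
  obtain ⟨ψ, hψ⟩ := exists_hom_τ₃ (loop_shortExact N) hM₂ f
  have h : StablyTrivial (φ ≫ ψ).τ₁ := hA _ _ ψ.τ₁ (fun n => by
    have := moduleTate_map_τ_iff (loop_shortExact M) (loop_shortExact N) ψ hM₂ hN₂ (n - 1)
    rw [sub_add_cancel] at this
    rw [← this, hψ]
    exact hf _) φ.τ₁
  have := stablyTrivial_τ₃ (susp_shortExact A) (φ ≫ ψ) hN₂ h
  rwa [ShortComplex.comp_τ₃, hφ, hψ] at this

theorem IsGhostTest.loop {A : ModuleCat.{u} k[G]} (hA : IsGhostTest A) : IsGhostTest (loop A) := by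
  intro M N f hf u
  let S := ShortComplex.kernelSequence (Projective.π A)
  have hS₂ : Projective S.X₂ := inferInstanceAs (Projective (Projective.over A))
  have hM₂ : Injective (ShortComplex.cokernelSequence (Injective.ι M)).X₂ :=
    inferInstanceAs (Injective (Injective.under M))
  have hN₂ : Injective (ShortComplex.cokernelSequence (Injective.ι N)).X₂ :=
    inferInstanceAs (Injective (Injective.under N))
  obtain ⟨φ, hφ⟩ := exists_hom_τ₁ (loop_shortExact A) hM₂ (S := S) u
  obtain ⟨ψ, hψ⟩ := exists_hom_τ₁ (susp_shortExact M) hN₂ f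
  have h : StablyTrivial (φ ≫ ψ).τ₃ := hA _ _ ψ.τ₃ (fun n => by
    rw [moduleTate_map_τ_iff (susp_shortExact M) (susp_shortExact N) ψ
      (projective_of_injective _) (projective_of_injective _) n, hψ]
    exact hf _) φ.τ₃
  have := stablyTrivial_τ₁ (susp_shortExact N) (φ ≫ ψ) hS₂ h
  rwa [ShortComplex.comp_τ₁, hφ, hψ] at this

theorem isGhostTest_suspPow (d : ℤ) : IsGhostTest (suspPow d (trivialModule k G)) := by
  obtain n | n := d
  · exact Function.Iterate.rec IsGhostTest isGhostTest_trivialModule (fun _ h => IsGhostTest.susp h) n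
  · exact Function.Iterate.rec IsGhostTest isGhostTest_trivialModule (fun _ h => IsGhostTest.loop h) (n + 1)

theorem GhostProjective.comp_eq_zero {P X Y : StMod k G} (hP : GhostProjective P) (u : P ⟶ X)
    (f : X ⟶ Y) (hf : IsGhost f) : u ≫ f = 0 := by
  obtain ⟨ι, d, ⟨r⟩⟩ := hP
  obtain ⟨M⟩ := X
  obtain ⟨N⟩ := Y
  obtain ⟨f, rfl⟩ := (toStMod k G).map_surjective (X := M) (Y := N) f
  suffices h : (r.r ≫ u) ≫ (toStMod k G).map f = 0 by
    have := r.i ≫= h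
    rwa [Category.assoc, r.retract_assoc, Limits.comp_zero] at this
  obtain ⟨v, hv⟩ := (toStMod k G).map_surjective (Y := M) (r.r ≫ u)
  change (toStMod k G).obj _ ⟶ (toStMod k G).obj M at u
  have h : StablyTrivial (v ≫ f) := stablyTrivial_directSum _ fun i w hw => by
    classical
    have := isGhostTest_suspPow (d i) M N f hf (ModuleCat.ofHom
      (v.hom ∘ₗ DirectSum.lof k[G] ι (fun i => suspPow (d i) (trivialModule k G)) i))
    convert this using 1
    ext m
    rw [hw]
    simp only [ModuleCat.hom_comp, LinearMap.comp_apply]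
    congr!
  rw [← toStMod_map_eq_zero_iff, Functor.map_comp] at h
  rw [← h]
  exact congrArg (· ≫ (toStMod k G).map f) hv.symm

/-! ### The ghost length is at most the generating length -/

/-- The second map is a weak cokernel of the first. A representative of `h` restricted to the
submodule factors through a projective, hence injective, module; that factorisation extends to the
middle term, and subtracting it leaves a map that vanishes on the submodule. -/
theorem IsCofibreSequence.exists_desc {X Y Z W : StMod k G} {f : X ⟶ Y} {g : Y ⟶ Z}
    (hfg : IsCofibreSequence f g) (h : Y ⟶ W) (hh : f ≫ h = 0) : ∃ h' : Z ⟶ W, g ≫ h' = h := by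
  obtain ⟨S, hS, a, b, c, hf, hg⟩ := hfg
  obtain ⟨W⟩ := W
  obtain ⟨t, ht⟩ := (toStMod k G).map_surjective (X := S.X₂) (Y := W) (b.inv ≫ h)
  have h1 : StablyTrivial (S.f ≫ t) := by
    rw [← toStMod_map_eq_zero_iff, Functor.map_comp, ← cancel_epi a.hom, ← reassoc_of% hf]
    refine (congrArg (fun s => f ≫ b.hom ≫ s) ht).trans ?_
    rw [b.hom_inv_id_assoc, hh, Limits.comp_zero]
  obtain ⟨Q, hQ, p, q, hpq⟩ := h1
  have := injective_of_projective Q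
  have := hS.mono_f
  have := hS.epi_g
  let r : S.X₂ ⟶ Q := Injective.factorThru p S.f
  have hr : S.f ≫ r = p := Injective.comp_factorThru p S.f
  have h0 : S.f ≫ (t - r ≫ q) = 0 := by
    rw [Preadditive.comp_sub, reassoc_of% hr, hpq, sub_self]
  refine ⟨c.hom ≫ (toStMod k G).map (hS.exact.desc _ h0), ?_⟩
  have h2 : (toStMod k G).map (r ≫ q) = 0 := (toStMod_map_eq_zero_iff _).2 ⟨Q, hQ, r, q, rfl⟩
  rw [reassoc_of% hg, ← Functor.map_comp, hS.exact.g_desc, Functor.map_sub, h2, sub_zero]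
  refine (congrArg (fun s => b.hom ≫ s) ht).trans ?_
  rw [b.hom_inv_id_assoc]

theorem GhostProjectivePow.comp_eq_zero {S : ObjectProperty (StMod k G)} {n : ℕ}
    {Y Z : StMod k G} {g : Y ⟶ Z} (hg : GhostPower S n g) :
    ∀ {X : StMod k G} (_ : GhostProjectivePow n X) (h : X ⟶ Y), h ≫ g = 0 := by
  induction hg with
  | zero hX hY f => exact fun hX' h => hX'.eq_of_src _ _
  | @succ n Y Y' Z hX f g hf hg ih =>
    rintro X ⟨P, M, Q, p, q, hpq, hP, hQ, ⟨r⟩⟩ h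
    -- The first ghost is spent on `P`; the other `n` act on a map out of `Q`.
    obtain ⟨s, hs⟩ := hpq.exists_desc (r.r ≫ h ≫ f) (by
      simpa only [Category.assoc] using hP.comp_eq_zero (p ≫ r.r ≫ h) f hf)
    have h1 : r.r ≫ h ≫ f ≫ g = 0 := by
      have := hs =≫ g
      rw [Category.assoc, ih hQ, Limits.comp_zero] at this
      simpa only [Category.assoc] using this.symm
    have := r.i ≫= h1
    rwa [r.retract_assoc, Limits.comp_zero] at this

theorem ghostLength_le_generatingLength (X : StMod k G) : ghostLength X ≤ generatingLength X :=
  le_iInf₂ fun n hn => iInf₂_le n fun Y f hf => by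
    simpa using GhostProjectivePow.comp_eq_zero hf hn (𝟙 X)

theorem ghostNumber_le_generatingNumber : ghostNumber k G ≤ generatingNumber k G :=
  iSup₂_mono fun X _ => ghostLength_le_generatingLength X


/-! ### The quaternion group -/

section Quaternion

variable {G : Type u} [Group G] (e : G ≃* QuaternionGroup 2)

/-- The generator `i` of a quaternion group. -/
abbrev quatI : G := e.symm (QuaternionGroup.a 1)

/-- The generator `j` of a quaternion group. -/
abbrev quatJ : G := e.symm (QuaternionGroup.xa 0)

/-- The central involution `ε` of a quaternion group. -/
abbrev quatE : G := quatI e ^ 2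

theorem quatE_eq : quatE e = e.symm (QuaternionGroup.a 2) :=
  (map_pow e.symm _ 2).symm

theorem quatI_mul_quatI : quatI e * quatI e = quatE e := (sq _).symm

theorem quatJ_mul_quatJ : quatJ e * quatJ e = quatE e := by
  rw [quatE_eq, ← map_mul]; rfl

theorem quatE_mul_quatE : quatE e * quatE e = 1 := by
  rw [quatE_eq, ← map_mul, ← map_one e.symm]; rfl

theorem quatE_ne_one : quatE e ≠ 1 := by
  rw [quatE_eq, ← map_one e.symm]
  exact e.symm.injective.ne (by decide)

theorem quatJ_mul_quatI : quatJ e * quatI e = quatE e * (quatI e * quatJ e) := by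
  simp only [quatE_eq, ← map_mul]; rfl

theorem quatE_comm (g : G) : g * quatE e = quatE e * g := by
  obtain ⟨g, rfl⟩ := e.symm.surjective g
  rw [quatE_eq, ← map_mul, ← map_mul]
  exact congrArg _ (by revert g; decide)

theorem quat_comm_or (g h : G) : g * h = h * g ∨ g * h = h * g * quatE e := by
  obtain ⟨g, rfl⟩ := e.symm.surjective g
  obtain ⟨h, rfl⟩ := e.symm.surjective h
  simp only [quatE_eq, ← map_mul, e.symm.injective.eq_iff]
  revert g h
  decide

theorem quat_induction {P : G → Prop} (one : P 1) (hi : ∀ g, P g → P (quatI e * g))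
    (hj : ∀ g, P g → P (quatJ e * g)) (g : G) : P g := by
  have ha (t : ℕ) : P (e.symm (QuaternionGroup.a 1 ^ t)) := by
    induction t with
    | zero => simpa using one
    | succ t ih =>
      rw [pow_succ', map_mul]
      exact hi _ ih
  have ha' (t : ZMod (2 * 2)) : P (e.symm (QuaternionGroup.a t)) := by
    have := ha t.val
    rwa [QuaternionGroup.a_one_pow, ZMod.natCast_zmod_val] at this
  obtain ⟨g, rfl⟩ := e.symm.surjective g
  obtain t | t := g
  · exact ha' t
  · have := hj _ (ha' t)
    rwa [← map_mul, QuaternionGroup.xa_mul_a, zero_add] at this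

/-- The elements are written with `ε` first, then `i`, then `j`, the normal form to which products
are reduced in `words_quat_subset`. -/
theorem quat_sum [Fintype G] {A : Type*} [AddCommMonoid A] (f : G → A) :
    ∑ g, f g = f 1 + f (quatI e) + f (quatE e) + f (quatE e * quatI e) +
      (f (quatJ e) + f (quatE e * (quatI e * quatJ e)) + f (quatE e * quatJ e) +
        f (quatI e * quatJ e)) := by
  let E : ZMod (2 * 2) ⊕ ZMod (2 * 2) ≃ QuaternionGroup 2 :=
    { toFun := Sum.elim QuaternionGroup.a QuaternionGroup.xa
      invFun := fun x => match x with
        | .a t => Sum.inl t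
        | .xa t => Sum.inr t
      left_inv := by rintro (t | t) <;> rfl
      right_inv := by rintro (t | t) <;> rfl }
  rw [← (E.trans e.symm.toEquiv).sum_comp f, Fintype.sum_sum_type]
  have h4 (f : ZMod (2 * 2) → A) : ∑ t, f t = f 0 + f 1 + f 2 + f 3 := Fin.sum_univ_four f
  rw [h4, h4]
  simp only [quatE_eq, ← map_mul, ← map_one e.symm]
  rfl

end Quaternion

/-! ### Words of length four in `1 + i` and `1 + j` -/

section Words

variable {A : Type*} [Ring A]

/-- The products of `n` factors, each of which is `x` or `y`. -/
def words (x y : A) : ℕ → Set A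
  | 0 => {1}
  | n + 1 => {a | ∃ w ∈ words x y n, a = x * w ∨ a = y * w}

theorem words_four_subset {x y z N : A} (hx : x * x = z) (hy : y * y = z) (hz : z * z = 0)
    (hxy : z * (x * y) = N) (hyx : z * (y * x) = N) (hxyxy : x * (y * (x * y)) = N)
    (hyxyx : y * (x * (y * x)) = N) : words x y 4 ⊆ {0, N} := by
  have hx' (a : A) : x * (x * a) = z * a := by rw [← mul_assoc, hx]
  have hy' (a : A) : y * (y * a) = z * a := by rw [← mul_assoc, hy]
  have hxz : x * z = z * x := by rw [← hx, mul_assoc]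
  have hyz : y * z = z * y := by rw [← hy, mul_assoc]
  have hxz' (a : A) : x * (z * a) = z * (x * a) := by rw [← mul_assoc, hxz, mul_assoc]
  have hyz' (a : A) : y * (z * a) = z * (y * a) := by rw [← mul_assoc, hyz, mul_assoc]
  rintro _ ⟨_, ⟨_, ⟨_, ⟨_, rfl, rfl | rfl⟩, rfl | rfl⟩, rfl | rfl⟩, rfl | rfl⟩ <;>
    simp only [mul_one, hx, hy, hx', hy', hz, hxz, hyz, hxz', hyz', hxy, hyx, hxyxy, hyxyx,
      Set.mem_insert_iff, Set.mem_singleton_iff, true_or, or_true]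

end Words

section GroupAlgebra

variable {k G : Type u} [Field k] [CharP k 2] [Group G] [Fintype G] (e : G ≃* QuaternionGroup 2)

theorem add_self_groupAlgebra {k G : Type u} [Field k] [CharP k 2] [Group G] (r : k[G]) :
    r + r = 0 := by
  rw [← two_smul k r, CharTwo.two_eq_zero, zero_smul]

/-- The element `1 + g` of the group algebra. -/
noncomputable abbrev onePlus (k : Type u) {G : Type u} [Field k] [Group G] (g : G) : k[G] :=
  MonoidAlgebra.of k G g + 1

theorem words_quat_subset : words (onePlus k (quatI e)) (onePlus k (quatJ e)) 4 ⊆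
    {0, ∑ g : G, MonoidAlgebra.of k G g} := by
  rw [quat_sum e]
  simp only [map_mul, map_one]
  have hii := congrArg (MonoidAlgebra.of k G) (quatI_mul_quatI e)
  have hjj := congrArg (MonoidAlgebra.of k G) (quatJ_mul_quatJ e)
  have hee := congrArg (MonoidAlgebra.of k G) (quatE_mul_quatE e)
  have hji := congrArg (MonoidAlgebra.of k G) (quatJ_mul_quatI e)
  have hie := congrArg (MonoidAlgebra.of k G) (quatE_comm e (quatI e))
  have hje := congrArg (MonoidAlgebra.of k G) (quatE_comm e (quatJ e))
  simp only [map_mul, map_one] at hii hjj hee hji hie hje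
  unfold onePlus
  generalize MonoidAlgebra.of k G (quatI e) = I at *
  generalize MonoidAlgebra.of k G (quatJ e) = J at *
  generalize MonoidAlgebra.of k G (quatE e) = E at *
  have hii' (a : k[G]) : I * (I * a) = E * a := by rw [← mul_assoc, hii]
  have hee' (a : k[G]) : E * (E * a) = a := by rw [← mul_assoc, hee, one_mul]
  have hji' (a : k[G]) : J * (I * a) = E * (I * (J * a)) := by
    rw [← mul_assoc, hji, mul_assoc, mul_assoc]
  have hie' (a : k[G]) : I * (E * a) = E * (I * a) := by rw [← mul_assoc, hie, mul_assoc]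
  have hje' (a : k[G]) : J * (E * a) = E * (J * a) := by rw [← mul_assoc, hje, mul_assoc]
  have h2 (a : k[G]) : (2 : ℤ) • a = 0 := by rw [two_smul, add_self_groupAlgebra]
  -- In characteristic `2` the squares of `I + 1` and `J + 1` are both `E + 1`. After expansion to
  -- normal form, whatever remains of each difference has coefficient `2`.
  refine words_four_subset (z := E + 1) ?_ ?_ ?_ ?_ ?_ ?_ ?_ <;>
    rw [← sub_eq_zero] <;>
    simp only [mul_add, add_mul, mul_one, one_mul, hii, hjj, hee, hji, hie, hje, hii',
      hee', hji', hie', hje'] <;>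
    abel_nf <;> simp only [h2, add_zero]

end GroupAlgebra


open ModuleCat

/-! ### Invariants -/

section Invariants

variable {k G : Type u} [Field k] [Group G]

theorem of_smul_smul_eq {M : Type u} [AddCommGroup M] [Module k[G] M] {m : M}
    (hm : ∀ g : G, MonoidAlgebra.of k G g • m = m) (r : k[G]) (g : G) :
    MonoidAlgebra.of k G g • r • m = r • m := by
  induction r using MonoidAlgebra.induction_on with
  | of h => rw [hm, hm]
  | add a b ha hb => rw [add_smul, smul_add, ha, hb]
  | smul c a ha =>
    rw [Algebra.smul_def, mul_smul, smul_smul (MonoidAlgebra.of k G g), ← Algebra.commutes,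
      mul_smul, ha]

/-- The submodule of invariants. -/
def invariantSubmodule (k G : Type u) [Field k] [Group G] (M : Type u) [AddCommGroup M]
    [Module k[G] M] : Submodule k[G] M where
  carrier := {m | ∀ g : G, MonoidAlgebra.of k G g • m = m}
  add_mem' ha hb g := by rw [smul_add, ha, hb]
  zero_mem' g := smul_zero _
  smul_mem' r _ hm g := of_smul_smul_eq hm r g

/-- A `k`-basis exhibits a module with trivial action as a sum of copies of `k`, all in degree `0`;
only the retract half of the isomorphism is needed. -/
theorem ghostProjective_of_trivial (P : ModuleCat.{u} k[G])
    (hP : ∀ (g : G) (p : P), MonoidAlgebra.of k G g • p = p) :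
    GhostProjective ((toStMod k G).obj P) := by
  classical
  let b := Module.Basis.ofVectorSpace k P
  let ι := Module.Basis.ofVectorSpaceIndex k P
  let T : ι → ModuleCat.{u} k[G] := fun _ => suspPow (Int.ofNat 0) (trivialModule k G)
  let D := ModuleCat.of k[G] (DirectSum ι fun i => T i)
  have hT (i : ι) (g : G) (c : T i) : MonoidAlgebra.of k G g • c = c := of_smul_trivialModule g c
  have hD (g : G) (d : D) : MonoidAlgebra.of k G g • d = d :=
    DFinsupp.ext fun i => hT i g _
  let E (i : ι) : T i ≃ₗ[k] k := trivialModuleEquiv k G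
  let f : P →ₗ[k[G]] D := equivariantMap
    (b.constr k fun i => (DirectSum.lof k[G] ι (fun i => T i) i ((E i).symm 1) : D))
    fun g m => by rw [hP, hD]
  let h : D →ₗ[k[G]] P := DirectSum.toModule k[G] ι P fun i =>
    equivariantMap (X := T i) (LinearMap.toSpanSingleton k P (b i) ∘ₗ (E i).toLinearMap)
      fun g m => by rw [hP, hT i]
  refine ⟨ι, fun _ => Int.ofNat 0, ⟨Retract.map ⟨ofHom f, ofHom h, ?_⟩ (toStMod k G)⟩⟩
  ext1
  have : (h ∘ₗ f).restrictScalars k = LinearMap.id := by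
    refine b.ext fun i => ?_
    have h1 : f (b i) = DirectSum.lof k[G] ι (fun i => T i) i ((E i).symm 1) :=
      b.constr_basis k _ i
    rw [LinearMap.restrictScalars_apply, LinearMap.comp_apply, h1, DirectSum.toModule_lof]
    change ((E i) ((E i).symm 1)) • b i = b i
    rw [LinearEquiv.apply_symm_apply, one_smul]
  exact LinearMap.ext fun m => DFunLike.congr_fun this m

theorem shortExact_mkQ {M : ModuleCat.{u} k[G]} {A : ModuleCat.{u} k[G]} (f : A ⟶ M)
    (hf : Function.Injective f.hom) :
    (ShortComplex.mk f (ofHom f.hom.range.mkQ) (by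
      ext m; exact (Submodule.Quotient.mk_eq_zero _).2 ⟨m, rfl⟩)).ShortExact where
  exact := by
    rw [ShortComplex.moduleCat_exact_iff]
    intro m hm
    exact (Submodule.Quotient.mk_eq_zero _).1 hm
  mono_f := (ModuleCat.mono_iff_injective _).2 hf
  epi_g := (ModuleCat.epi_iff_surjective _).2 (Submodule.mkQ_surjective _)

theorem isCofibreSequence_of_shortExact {S : ShortComplex (ModuleCat.{u} k[G])}
    (hS : S.ShortExact) : IsCofibreSequence ((toStMod k G).map S.f) ((toStMod k G).map S.g) :=
  ⟨S, hS, Iso.refl _, Iso.refl _, Iso.refl _, by simp, by simp⟩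

theorem isZero_toStMod (M : ModuleCat.{u} k[G]) [Subsingleton M] :
    Limits.IsZero ((toStMod k G).obj M) :=
  (toStMod k G).map_isZero (ModuleCat.isZero_of_subsingleton M)

end Invariants

theorem finrank_lt_of_surjective {k V W : Type*} [Field k] [AddCommGroup V] [Module k V]
    [Module.Finite k V] [AddCommGroup W] [Module k W] {q : V →ₗ[k] W}
    (hq : Function.Surjective q) {v : V} (hv : v ≠ 0) (hqv : q v = 0) :
    Module.finrank k W < Module.finrank k V := by
  have h1 := q.finrank_range_add_finrank_ker
  rw [LinearMap.range_eq_top.2 hq, finrank_top] at h1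
  have h2 : Module.finrank k (LinearMap.ker q) ≠ 0 := fun h0 => by
    have h4 : v ∈ LinearMap.ker q := hqv
    rw [Submodule.finrank_eq_zero.1 h0] at h4
    exact hv h4
  omega

/-! ### Filtrations by invariants -/

section Quaternion

variable {k G : Type u} [Field k] [CharP k 2] [Group G] (e : G ≃* QuaternionGroup 2)

theorem add_self_module {M : Type u} [AddCommGroup M] [Module k[G] M] (m : M) : m + m = 0 := by
  rw [← one_smul k[G] m, ← add_smul, add_self_groupAlgebra, zero_smul]

theorem onePlus_smul_eq_zero_iff {M : Type u} [AddCommGroup M] [Module k[G] M] (g : G) (m : M) :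
    onePlus k g • m = 0 ↔ MonoidAlgebra.of k G g • m = m := by
  rw [add_smul, one_smul]
  constructor
  · intro h
    rw [eq_neg_of_add_eq_zero_left h, ← eq_neg_of_add_eq_zero_left (add_self_module (k := k) (G := G) m)]
  · intro h
    rw [h, add_self_module (k := k) (G := G)]

theorem of_smul_eq_self {M : Type u} [AddCommGroup M] [Module k[G] M] {m : M}
    (hi : onePlus k (quatI e) • m = 0) (hj : onePlus k (quatJ e) • m = 0) (g : G) :
    MonoidAlgebra.of k G g • m = m := by
  rw [onePlus_smul_eq_zero_iff] at hi hj
  induction g using quat_induction e with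
  | one => rw [map_one, one_smul]
  | hi g ih => rw [map_mul, mul_smul, ih, hi]
  | hj g ih => rw [map_mul, mul_smul, ih, hj]

/-- The words of length `n` in `1 + i` and `1 + j` annihilate `M`. -/
def IsKilled (k : Type u) {G : Type u} [Field k] [Group G] (e : G ≃* QuaternionGroup 2) (n : ℕ)
    (M : Type u) [AddCommGroup M] [Module k[G] M] : Prop :=
  ∀ w ∈ words (onePlus k (quatI e)) (onePlus k (quatJ e)) n, ∀ m : M, w • m = 0

omit [CharP k 2] in
theorem IsKilled.subsingleton {M : Type u} [AddCommGroup M] [Module k[G] M]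
    (h : IsKilled k e 0 M) : Subsingleton M :=
  subsingleton_of_forall_eq 0 fun m => by simpa using h 1 rfl m

theorem IsKilled.mem_invariantSubmodule {M : Type u} [AddCommGroup M] [Module k[G] M] {n : ℕ}
    (h : IsKilled k e (n + 1) M) {w : k[G]}
    (hw : w ∈ words (onePlus k (quatI e)) (onePlus k (quatJ e)) n) (m : M) :
    w • m ∈ invariantSubmodule k G M :=
  of_smul_eq_self e (by rw [smul_smul]; exact h _ ⟨w, hw, Or.inl rfl⟩ m)
    (by rw [smul_smul]; exact h _ ⟨w, hw, Or.inr rfl⟩ m)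

/-- A nonzero value of a longest word that does not annihilate `M` is invariant. No finiteness of
`M` is required. -/
theorem IsKilled.exists_invariant {M : Type u} [AddCommGroup M] [Module k[G] M] [Nontrivial M]
    {n : ℕ} (h : IsKilled k e n M) : ∃ m ∈ invariantSubmodule k G M, m ≠ 0 := by
  induction n with
  | zero => exact absurd h.subsingleton (not_subsingleton M)
  | succ n ih =>
    by_cases h' : IsKilled k e n M
    · exact ih h'
    · unfold IsKilled at h'
      push Not at h'
      obtain ⟨w, hw, m, hm⟩ := h'
      exact ⟨w • m, h.mem_invariantSubmodule e hw m, hm⟩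

/-- Words of length `n` map `M` into its invariants, so they annihilate the quotient by the
invariants, while the invariants lie in `𝓕`. -/
theorem IsKilled.ghostProjectivePow {n : ℕ} : ∀ (M : ModuleCat.{u} k[G]) (_ : IsKilled k e n M),
    GhostProjectivePow n ((toStMod k G).obj M) := by
  induction n with
  | zero =>
    intro M h
    have := h.subsingleton
    exact isZero_toStMod M
  | succ n ih =>
    intro M h
    let P := invariantSubmodule k G M
    let f : ModuleCat.of k[G] P ⟶ M := ofHom P.subtype
    have hf : Function.Injective f.hom := P.subtype_injective
    refine ⟨_, _, _, _, _, isCofibreSequence_of_shortExact (shortExact_mkQ f hf), ?_, ?_,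
      ⟨Retract.refl _⟩⟩
    · exact ghostProjective_of_trivial _ fun g p => Subtype.ext (p.2 g)
    · refine ih _ fun w hw q => ?_
      obtain ⟨m, rfl⟩ := Submodule.mkQ_surjective _ q
      rw [← map_smul]
      exact (Submodule.Quotient.mk_eq_zero _).2 ⟨⟨_, h.mem_invariantSubmodule e hw m⟩, rfl⟩

/-- Induction on dimension: an invariant vector spans a copy of `k`, and the quotient by it is
smaller. -/
theorem IsKilled.mem_of_isThick {n : ℕ} {S : ObjectProperty (StMod k G)} (hS : IsThick S)
    {T : ModuleCat.{u} k[G]} (E : T ≃ₗ[k] k)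
    (hT : ∀ (g : G) (c : T), MonoidAlgebra.of k G g • c = c)
    (hk : S ((toStMod k G).obj T)) (d : ℕ) : ∀ (M : ModuleCat.{u} k[G])
    (_ : IsKilled k e n M) (_ : Module.Finite k M) (_ : Module.finrank k M = d),
    S ((toStMod k G).obj M) := by
  induction d using Nat.strong_induction_on with
  | _ d ih =>
    intro M h hfin hd
    obtain hM | hM := subsingleton_or_nontrivial M
    · exact hS.zero _ (isZero_toStMod M)
    obtain ⟨v, hv, hv0⟩ := h.exists_invariant e
    let f : T ⟶ M := ofHom (equivariantMap
      (LinearMap.toSpanSingleton k M v ∘ₗ E.toLinearMap) fun g c => by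
        rw [hT, LinearMap.comp_apply, LinearMap.toSpanSingleton_apply,
          smul_algebra_smul_comm, hv g])
    have hf : Function.Injective f.hom := by
      refine (injective_iff_map_eq_zero _).2 fun c hc => ?_
      have h1 : E c • v = 0 := hc
      exact E.map_eq_zero_iff.1 ((smul_eq_zero_iff_left hv0).1 h1)
    let Q := ModuleCat.of k[G] (M ⧸ f.hom.range)
    let p : M ⟶ Q := ofHom f.hom.range.mkQ
    let q : M →ₗ[k] Q := p.hom.restrictScalars k
    have hp : Function.Surjective p.hom := Submodule.mkQ_surjective f.hom.range
    have hq : Function.Surjective q := hp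
    have hfinQ : Module.Finite k Q := Module.Finite.of_surjective q hq
    refine hS.second _ _ _ _ _ (isCofibreSequence_of_shortExact (shortExact_mkQ f hf)) hk
      (ih (Module.finrank k Q) ?_ Q ?_ hfinQ rfl)
    · rw [← hd]
      exact finrank_lt_of_surjective hq hv0 ((Submodule.Quotient.mk_eq_zero _).2 ⟨E.symm 1, by
        change E (E.symm 1) • v = v
        rw [LinearEquiv.apply_symm_apply, one_smul]⟩)
    · intro w hw t
      obtain ⟨m, rfl⟩ := Submodule.mkQ_surjective _ t
      rw [← map_smul, h w hw m, map_zero]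

end Quaternion


open ModuleCat

/-! ### Splitting off a free summand -/

section FreeSummand

variable {k G : Type u} [Field k] [Group G]

theorem injective_of_invariants {X Y : Type u} [AddCommGroup X] [Module k[G] X]
    [AddCommGroup Y] [Module k[G] Y] (hX : ∀ K : Submodule k[G] X, K ≠ ⊥ →
      ∃ w ∈ K, w ≠ 0 ∧ ∀ g : G, MonoidAlgebra.of k G g • w = w) (L : X →ₗ[k[G]] Y)
    (hL : ∀ w, (∀ g : G, MonoidAlgebra.of k G g • w = w) → L w = 0 → w = 0) :
    Function.Injective L := by
  rw [← LinearMap.ker_eq_bot]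
  by_contra h
  obtain ⟨w, hw, hw0, hwg⟩ := hX _ h
  exact hw0 (hL w hwg hw)

variable [Fintype G]

/-- The sum of the group elements in the group algebra. -/
noncomputable abbrev normElement (k G : Type u) [Field k] [Group G] [Fintype G] : k[G] :=
  ∑ g : G, MonoidAlgebra.of k G g

theorem of_mul_normElement (x : G) : MonoidAlgebra.of k G x * normElement k G = normElement k G := by
  rw [Finset.mul_sum]
  exact Fintype.sum_equiv (Equiv.mulLeft x) _ _ fun g => (map_mul _ _ _).symm

theorem eq_coeff_one_smul_normElement {r : k[G]} (hr : ∀ g : G, MonoidAlgebra.of k G g * r = r) :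
    r.coeff 1 • normElement k G = r := by
  classical
  ext g
  have h : r.coeff g = r.coeff 1 := by
    conv_lhs => rw [← hr g]
    simp
  simp [h, MonoidAlgebra.coeff_sum, Finsupp.single_apply]

/-- The `k`-linear map `c ↦ N c` from the coordinates to the free module. -/
noncomputable def normFinsupp (k G : Type u) [Field k] [Group G] [Fintype G] (ι : Type u) :
    (ι →₀ k) →ₗ[k] (ι →₀ k[G]) :=
  Finsupp.mapRange.linearMap (LinearMap.toSpanSingleton k k[G] (normElement k G))

theorem exists_normFinsupp_eq {ι : Type u} {w : ι →₀ k[G]}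
    (hw : ∀ g : G, MonoidAlgebra.of k G g • w = w) : ∃ c, normFinsupp k G ι c = w := by
  refine ⟨w.mapRange (fun r => r.coeff 1) rfl, Finsupp.ext fun t => ?_⟩
  simp only [normFinsupp, Finsupp.mapRange.linearMap_apply, Finsupp.mapRange_apply,
    LinearMap.toSpanSingleton_apply]
  exact eq_coeff_one_smul_normElement fun g => DFunLike.congr_fun (hw g) t

/-- Choose preimages under `N` of a `k`-basis of `N M`; they generate a free submodule, because the
map from the free module is injective on invariants and every nonzero submodule contains nonzero
invariants. Being injective, this free module splits off, and it already accounts for all of `N M`,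
so `N` kills the complement. -/
theorem exists_free_splitting (hF : ∀ (ι : Type u) (K : Submodule k[G] (ι →₀ k[G])), K ≠ ⊥ →
      ∃ w ∈ K, w ≠ 0 ∧ ∀ g : G, MonoidAlgebra.of k G g • w = w) (M : ModuleCat.{u} k[G]) :
    ∃ M' : ModuleCat.{u} k[G], (∀ m : M', normElement k G • m = 0) ∧
      Nonempty (Retract ((toStMod k G).obj M) ((toStMod k G).obj M')) := by
  let V := LinearMap.range (Algebra.lsmul k k M (normElement k G))
  let b := Module.Basis.ofVectorSpace k V
  let ι := Module.Basis.ofVectorSpaceIndex k V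
  choose m hm using fun t : ι => (b t).2
  let L : (ι →₀ k[G]) →ₗ[k[G]] M := Finsupp.linearCombination k[G] m
  have hLJ (c : ι →₀ k) : L (normFinsupp k G ι c) = (b.repr.symm c : M) := by
    have : L.restrictScalars k ∘ₗ normFinsupp k G ι = V.subtype ∘ₗ b.repr.symm.toLinearMap := by
      refine Finsupp.lhom_ext' fun t => LinearMap.ext_ring ?_
      simp only [LinearMap.comp_apply, LinearMap.restrictScalars_apply, Finsupp.lsingle_apply,
        normFinsupp, Finsupp.mapRange.linearMap_apply, Finsupp.mapRange_single, L,
        Finsupp.linearCombination_single, LinearMap.toSpanSingleton_apply, one_smul,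
        LinearEquiv.coe_coe, Module.Basis.repr_symm_single_one, Submodule.subtype_apply]
      exact hm t
    exact DFunLike.congr_fun this c
  have hLinj : Function.Injective L := injective_of_invariants (hF ι) L fun w hw hw0 => by
    obtain ⟨c, rfl⟩ := exists_normFinsupp_eq hw
    rw [hLJ] at hw0
    rw [b.repr.symm.map_eq_zero_iff.1 (Subtype.ext hw0), map_zero]
  let F := ModuleCat.of k[G] (ι →₀ k[G])
  have hFp : Projective F := (IsProjective.iff_projective F).1 inferInstance
  have := injective_of_projective F
  let l : F ⟶ M := ofHom L
  have : Mono l := (ModuleCat.mono_iff_injective l).2 hLinj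
  let ρ : M ⟶ F := Injective.factorThru (𝟙 F) l
  have hρ : l ≫ ρ = 𝟙 F := Injective.comp_factorThru _ _
  have hρ' (c : F) : ρ.hom (L c) = c := congrArg (fun t => t.hom c) hρ
  let i : Limits.kernel ρ ⟶ M := Limits.kernel.ι ρ
  have hi : i ≫ ρ = 0 := Limits.kernel.condition ρ
  have hi' : Function.Injective i.hom := (ModuleCat.mono_iff_injective i).1 inferInstance
  refine ⟨Limits.kernel ρ, fun x => hi' ?_, ⟨⟨(toStMod k G).map
    (Limits.kernel.lift ρ (𝟙 M - ρ ≫ l) ?_), (toStMod k G).map i, ?_⟩⟩⟩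
  -- The element `N x` lies in the free summand, yet the retraction `ρ` sends it to `N (ρ x) = 0`.
  · obtain ⟨c, hc⟩ : ∃ c, L (normFinsupp k G ι c) = normElement k G • i.hom x :=
      ⟨b.repr ⟨_, i.hom x, rfl⟩, by rw [hLJ, b.repr.symm_apply_apply]; rfl⟩
    have hx : ρ.hom (i.hom x) = 0 := congrArg (fun t => t.hom x) hi
    have h0 : normFinsupp k G ι c = 0 := by
      have := hρ' (normFinsupp k G ι c)
      rw [hc, map_smul, hx, smul_zero] at this
      exact this.symm
    rw [map_smul, ← hc, h0, map_zero, map_zero]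
  · rw [Preadditive.sub_comp, Category.assoc, hρ, Category.id_comp, Category.comp_id, sub_self]
  · have h0 : (toStMod k G).map (ρ ≫ l) = 0 := (toStMod_map_eq_zero_iff _).2 ⟨F, hFp, ρ, l, rfl⟩
    rw [← Functor.map_comp, Limits.kernel.lift_ι, Functor.map_sub, h0, sub_zero, CategoryTheory.Functor.map_id]

end FreeSummand

/-! ### The upper bound -/

section Quaternion

variable {k G : Type u} [Field k] [CharP k 2] [Group G] (e : G ≃* QuaternionGroup 2)

theorem thickTrivial_of_finite (M : ModuleCat.{u} k[G]) [Module.Finite k M] (n : ℕ)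
    (hM : IsKilled k e n M) : thickTrivial k G ((toStMod k G).obj M) := fun _ hS hk =>
  hM.mem_of_isThick e hS (trivialModuleEquiv k G) of_smul_trivialModule hk _ M inferInstance rfl

variable [Fintype G]

theorem isKilled_four {M : Type u} [AddCommGroup M] [Module k[G] M]
    (hM : ∀ m : M, normElement k G • m = 0) : IsKilled k e 4 M := by
  intro w hw m
  obtain rfl | rfl := words_quat_subset e hw
  · exact zero_smul _ m
  · exact hM m

/-- Multiplying `N` by `1 + g` gives `2 N = 0`. This supplies nonzero invariants in every nonzero
submodule of a free module of any rank. -/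
theorem isKilled_five (M : Type u) [AddCommGroup M] [Module k[G] M] : IsKilled k e 5 M := by
  have h (g : G) {w : k[G]} (hw : w ∈ words (onePlus k (quatI e)) (onePlus k (quatJ e)) 4) :
      onePlus k g * w = 0 := by
    obtain rfl | rfl := words_quat_subset e hw
    · exact mul_zero _
    · rw [add_mul, one_mul, of_mul_normElement, add_self_groupAlgebra]
  rintro _ ⟨w, hw, rfl | rfl⟩ m
  · rw [h _ hw, zero_smul]
  · rw [h _ hw, zero_smul]

include e in
theorem ghostProjectivePow_four (X : StMod k G) : GhostProjectivePow 4 X := by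
  obtain ⟨M⟩ := X
  obtain ⟨M', hM', ⟨r⟩⟩ := exists_free_splitting (k := k) (G := G) (fun ι K hK => by
    have := Submodule.nontrivial_iff_ne_bot.2 hK
    obtain ⟨w, hw, hw0⟩ := (isKilled_five (k := k) e K).exists_invariant e
    exact ⟨w, w.2, fun h => hw0 (Subtype.ext h), fun g => congrArg Subtype.val (hw g)⟩) M
  obtain ⟨P, N, Q, f, g, hfg, hP, hQ, ⟨s⟩⟩ := (isKilled_four e hM').ghostProjectivePow e M'
  exact ⟨P, N, Q, f, g, hfg, hP, hQ, ⟨r.trans s⟩⟩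

include e in
theorem generatingNumber_le_four : generatingNumber k G ≤ 4 :=
  iSup₂_le fun X _ => iInf₂_le 4 (ghostProjectivePow_four e X)

end Quaternion


/-! ### The regular module of the quotient by a central involution -/

section QuotientRegular

open ModuleCat

variable {k G : Type u} [Field k] [CharP k 2] [Group G] {N : Subgroup G} [N.Normal] {ε : G}

/-- The ring homomorphism `k[G] → k[G ⧸ N]`. -/
noncomputable abbrev toQuotient (k : Type u) {G : Type u} [Field k] [Group G] (N : Subgroup G)
    [N.Normal] : k[G] →+* k[G ⧸ N] :=
  MonoidAlgebra.mapDomainRingHom k (QuotientGroup.mk' N)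

/-- The additive section of `k[G] → k[G ⧸ N]` given by coset representatives. -/
noncomputable abbrev cosetLift (v : k[G ⧸ N]) : k[G] :=
  MonoidAlgebra.mapDomain Quotient.out v

omit [CharP k 2] in
theorem toQuotient_cosetLift (v : k[G ⧸ N]) : toQuotient k N (cosetLift v) = v := by
  induction v using MonoidAlgebra.induction_linear with
  | zero => simp [cosetLift]
  | add a b ha hb => rw [cosetLift, MonoidAlgebra.mapDomain_add, map_add, ha, hb]
  | single v a => simp [cosetLift]

omit [CharP k 2] in
theorem single_mul_mul_onePlus (hε : ε * ε = 1) (g : G) (a : k) :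
    MonoidAlgebra.single (g * ε) a * onePlus k ε = MonoidAlgebra.single g a * onePlus k ε := by
  simp only [onePlus, mul_add, mul_one, MonoidAlgebra.of_apply, MonoidAlgebra.single_mul_single,
    mul_assoc, hε]
  exact add_comm _ _

omit [CharP k 2] in
-- The choice of coset representatives is invisible after multiplication by `1 + ε`, since `ε (1 +
-- ε) = 1 + ε`.
theorem cosetLift_toQuotient_mul (hε : ε * ε = 1) (hN : ∀ g ∈ N, g = 1 ∨ g = ε) (r : k[G]) :
    cosetLift (toQuotient k N r) * onePlus k ε = r * onePlus k ε := by
  induction r using MonoidAlgebra.induction_linear with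
  | zero => simp [cosetLift]
  | add a b ha hb => rw [map_add, cosetLift, MonoidAlgebra.mapDomain_add, add_mul, ha, hb, add_mul]
  | single g a =>
    obtain ⟨⟨n, hn⟩, h⟩ := QuotientGroup.mk_out_eq_mul N g
    simp only [MonoidAlgebra.mapDomainRingHom_apply, MonoidAlgebra.mapDomain_single, cosetLift,
      QuotientGroup.mk'_apply, h]
    obtain rfl | rfl := hN n hn
    · rw [mul_one]
    · exact single_mul_mul_onePlus hε g a

theorem exists_cosetLift_add (hN : ∀ g ∈ N, g = 1 ∨ g = ε) (r : k[G]) :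
    ∃ s, r = cosetLift (toQuotient k N r) + s * onePlus k ε := by
  induction r using MonoidAlgebra.induction_linear with
  | zero => exact ⟨0, by simp [cosetLift]⟩
  | add a b ha hb =>
    obtain ⟨s, hs⟩ := ha
    obtain ⟨t, ht⟩ := hb
    refine ⟨s + t, ?_⟩
    rw [map_add, cosetLift, MonoidAlgebra.mapDomain_add]
    nth_rw 1 [hs, ht]
    rw [add_mul, add_add_add_comm]
  | single g a =>
    obtain ⟨⟨n, hn⟩, h⟩ := QuotientGroup.mk_out_eq_mul N g
    simp only [MonoidAlgebra.mapDomainRingHom_apply, MonoidAlgebra.mapDomain_single, cosetLift,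
      QuotientGroup.mk'_apply, h]
    obtain rfl | rfl := hN n hn
    · exact ⟨0, by simp⟩
    · refine ⟨MonoidAlgebra.single g a, ?_⟩
      simp only [onePlus, mul_add, mul_one, MonoidAlgebra.of_apply,
        MonoidAlgebra.single_mul_single]
      rw [← add_assoc, add_self_groupAlgebra, zero_add]

omit [CharP k 2] in
theorem eq_zero_of_cosetLift_mul (hε : ε ≠ 1) (hεN : ε ∈ N) (v : k[G ⧸ N])
    (hv : cosetLift v * onePlus k ε = 0) : v = 0 := by
  classical
  -- A left inverse: keep only the coefficients at the chosen representatives. As `ε ≠ 1` lies in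
  -- `N`, the translate of a representative by `ε` is never one itself.
  let p : k[G] →+ k[G ⧸ N] := MonoidAlgebra.liftNC (algebraMap k k[G ⧸ N]).toAddMonoidHom
    fun g => if Quotient.out (g : G ⧸ N) = g then MonoidAlgebra.of k _ (g : G ⧸ N) else 0
  have hp (v : k[G ⧸ N]) : p (cosetLift v * onePlus k ε) = v := by
    induction v using MonoidAlgebra.induction_linear with
    | zero => simp [cosetLift]
    | add a b ha hb => rw [cosetLift, MonoidAlgebra.mapDomain_add, add_mul, map_add, ha, hb]
    | single v a =>
      have h1 : ((Quotient.out v * ε : G) : G ⧸ N) = v := by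
        rw [QuotientGroup.mk_mul_of_mem _ hεN]
        exact Quotient.out_eq v
      have h2 : ((Quotient.out v : G) : G ⧸ N) = v := Quotient.out_eq v
      simp [p, cosetLift, onePlus, mul_add, MonoidAlgebra.single_mul_single,
        MonoidAlgebra.liftNC_single, h1, h2, hε]
  rw [← hp v, hv, map_zero]

theorem toQuotient_onePlus (hεN : ε ∈ N) : toQuotient k N (onePlus k ε) = 0 := by
  have : (QuotientGroup.mk' N) ε = 1 := (QuotientGroup.eq_one_iff ε).2 hεN
  rw [onePlus, map_add, map_one, MonoidAlgebra.of_apply, MonoidAlgebra.mapDomainRingHom_apply,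
    MonoidAlgebra.mapDomain_single, this, ← MonoidAlgebra.one_def, add_self_groupAlgebra]

/-- The quotient map from the regular module of `G` to that of `G ⧸ N`. -/
noncomputable def regularQuotient (k : Type u) {G : Type u} [Field k] [Group G] (N : Subgroup G)
    [N.Normal] : ModuleCat.of k[G] k[G] ⟶ quotientRegular k N :=
  ModuleCat.ofHom (X := k[G]) (Y := quotientRegular k N)
    { toFun := fun r => toQuotient k N r
      map_add' := map_add (toQuotient k N)
      map_smul' := map_mul (toQuotient k N) }

/-- The inclusion of the regular module of `G ⧸ N` in that of `G`. -/
noncomputable def regularTransfer (k : Type u) {G : Type u} [Field k] [CharP k 2] [Group G]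
    (N : Subgroup G) [N.Normal] {ε : G} (hε : ε * ε = 1) (hN : ∀ g ∈ N, g = 1 ∨ g = ε) :
    quotientRegular k N ⟶ ModuleCat.of k[G] k[G] :=
  ModuleCat.ofHom (X := quotientRegular k N) (Y := k[G])
    { toFun := fun v => cosetLift (N := N) v * onePlus k ε
      map_add' := fun v w => by
        refine (congrArg (· * onePlus k ε) (MonoidAlgebra.mapDomain_add _ _ _)).trans (add_mul _ _ _)
      map_smul' := by
        intro r v
        change k[G ⧸ N] at v
        change cosetLift (N := N) (toQuotient k N r * v) * onePlus k ε =
          r * (cosetLift (N := N) v * onePlus k ε)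
        rw [← mul_assoc, ← cosetLift_toQuotient_mul hε hN (r * cosetLift (N := N) v), map_mul,
          toQuotient_cosetLift] }

theorem regular_shortExact (hε : ε * ε = 1) (hε' : ε ≠ 1) (hεN : ε ∈ N)
    (hN : ∀ g ∈ N, g = 1 ∨ g = ε) :
    (ShortComplex.mk (regularTransfer k N hε hN) (regularQuotient k N) (by
      ext v
      change toQuotient k N (cosetLift (N := N) v * onePlus k ε) = 0
      rw [map_mul, toQuotient_onePlus hεN, mul_zero])).ShortExact where
  exact := by
    rw [ShortComplex.moduleCat_exact_iff]
    intro r hr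
    change k[G] at r
    change toQuotient k N r = 0 at hr
    obtain ⟨s, hs⟩ := exists_cosetLift_add hN r
    refine ⟨toQuotient k N s, ?_⟩
    change cosetLift (toQuotient k N s) * onePlus k ε = r
    rw [cosetLift_toQuotient_mul hε hN, hs, hr]
    simp [cosetLift]
  mono_f := (ModuleCat.mono_iff_injective _).2
    ((injective_iff_map_eq_zero _).2 fun v hv => eq_zero_of_cosetLift_mul hε' hεN v hv)
  epi_g := (ModuleCat.epi_iff_surjective _).2 fun v => ⟨cosetLift (N := N) v,
    toQuotient_cosetLift (N := N) v⟩

omit [CharP k 2] in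
theorem finite_quotientRegular : Module.Finite k[G] (quotientRegular k N) :=
  Module.Finite.of_surjective (regularQuotient k N).hom fun v => ⟨cosetLift (N := N) v,
    toQuotient_cosetLift (N := N) v⟩

omit [CharP k 2] in
theorem sum_eq_zero_of_involution [Fintype G] {A : Type*} [AddCommGroup A] (hA : ∀ a : A, a + a = 0)
    (hε : ε * ε = 1) (hε' : ε ≠ 1) (f : G → A) (hf : ∀ g, f (g * ε) = f g) : ∑ g, f g = 0 :=
  Finset.sum_involution (fun g _ => g * ε) (fun g _ => by rw [hf, hA])
    (fun g _ _ h => hε' (mul_eq_left.1 h)) (fun _ _ => Finset.mem_univ _)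
    fun g _ => by rw [mul_assoc, hε, mul_one]

omit [CharP k 2] in
theorem of_mul_smul_quotientRegular (hεN : ε ∈ N) (g : G) (v : quotientRegular k N) :
    MonoidAlgebra.of k G (g * ε) • v = MonoidAlgebra.of k G g • v := by
  have h : toQuotient k N (MonoidAlgebra.of k G (g * ε)) = toQuotient k N (MonoidAlgebra.of k G g) := by
    simp only [MonoidAlgebra.of_apply, MonoidAlgebra.mapDomainRingHom_apply,
      MonoidAlgebra.mapDomain_single, QuotientGroup.mk'_apply, QuotientGroup.mk_mul_of_mem _ hεN]
  exact congrArg (· * (show k[G ⧸ N] from v)) h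

theorem normElement_smul_quotientRegular [Fintype G] (hε : ε * ε = 1) (hε' : ε ≠ 1) (hεN : ε ∈ N)
    (v : quotientRegular k N) : normElement k G • v = 0 := by
  rw [Finset.sum_smul]
  exact sum_eq_zero_of_involution (add_self_module (k := k) (G := G)) hε hε' _
    fun g => of_mul_smul_quotientRegular hεN g v

/-- A stably trivial map is a trace, and on `kV` the terms of a trace at `g` and `g ε` agree, so
they cancel; evaluating at `1` returns `v`. -/
theorem rightMul_eq_zero_of_stablyTrivial [Fintype G] (hε : ε * ε = 1) (hε' : ε ≠ 1) (hεN : ε ∈ N)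
    (hεc : ∀ g, g * ε = ε * g) {v : k[G ⧸ N]} (hv : StablyTrivial (rightMul k N v)) : v = 0 := by
  obtain ⟨θ, hθ⟩ := (stablyTrivial_iff _).1 hv
  obtain ⟨u, h1⟩ : ∃ u, (rightMul k N v).hom u = v := ⟨(1 : k[G ⧸ N]), one_mul v⟩
  rw [← hθ, traceMap_apply] at h1
  refine h1.symm.trans ?_
  refine sum_eq_zero_of_involution (add_self_module (k := k) (G := G)) hε hε' _ fun g => ?_
  have h2 : (g * ε)⁻¹ = g⁻¹ * ε := by
    rw [mul_inv_rev, inv_eq_of_mul_eq_one_left hε, hεc]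
  rw [h2, of_mul_smul_quotientRegular hεN, of_mul_smul_quotientRegular hεN]

theorem moduleTate_rightMul_eq_zero [Fintype G] (hε : ε * ε = 1) (hε' : ε ≠ 1) (hεN : ε ∈ N)
    (hN : ∀ g ∈ N, g = 1 ∨ g = ε) (hεc : ∀ g, g * ε = ε * g) (x : G)
    (hx : ∀ g : G, (g : G ⧸ N) * x = x * g) (n : ℤ) :
    (moduleTate k G n).map (rightMul k N (MonoidAlgebra.of k _ (x : G ⧸ N) + 1)) = 0 := by
  have hS := regular_shortExact (k := k) hε hε' hεN hN
  set S := ShortComplex.mk (regularTransfer k N hε hN) (regularQuotient k N) _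
  have hπ : toQuotient k N (onePlus k x) = MonoidAlgebra.of k _ (x : G ⧸ N) + 1 := by
    rw [onePlus, map_add, map_one, MonoidAlgebra.of_apply, MonoidAlgebra.mapDomainRingHom_apply,
      MonoidAlgebra.mapDomain_single]
    rfl
  have hc : onePlus k ε * onePlus k x = onePlus k x * onePlus k ε := by
    have : MonoidAlgebra.of k G ε * MonoidAlgebra.of k G x =
        MonoidAlgebra.of k G x * MonoidAlgebra.of k G ε := by rw [← map_mul, ← map_mul, hεc]
    simp only [onePlus, mul_add, add_mul, mul_one, one_mul, this]
    abel
  -- The outer components are the same map, so vanishing in degree `n` is equivalent to vanishing in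
  -- degree `n + 1`. Compatibility on the left uses that `ε` is central.
  let φ : S ⟶ S :=
    { τ₁ := rightMul k N (MonoidAlgebra.of k _ (x : G ⧸ N) + 1)
      τ₂ := ModuleCat.ofHom (LinearMap.toSpanSingleton k[G] k[G] (onePlus k x))
      τ₃ := rightMul k N (MonoidAlgebra.of k _ (x : G ⧸ N) + 1)
      comm₁₂ := by
        ext1
        refine LinearMap.ext fun v => ?_
        change k[G ⧸ N] at v
        change cosetLift (N := N) (v * (MonoidAlgebra.of k _ (x : G ⧸ N) + 1)) * onePlus k ε =
          cosetLift (N := N) v * onePlus k ε * onePlus k x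
        rw [mul_assoc, hc, ← mul_assoc, ← cosetLift_toQuotient_mul hε hN
          (cosetLift (N := N) v * onePlus k x), map_mul, toQuotient_cosetLift, hπ]
      comm₂₃ := by
        ext1
        refine LinearMap.ext fun r => ?_
        change toQuotient k N (r * onePlus k x) =
          toQuotient k N r * (MonoidAlgebra.of k _ (x : G ⧸ N) + 1)
        rw [map_mul, hπ] }
  have hp : Projective S.X₂ := (IsProjective.iff_projective k[G]).1 inferInstance
  have key (n : ℤ) := moduleTate_map_τ_iff hS hS φ hp hp n
  induction n using Int.induction_on with
  | zero =>
    -- Since `x` is central in the quotient, right multiplication by it agrees with the left action,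
    -- which fixes `m`; so `m (x + 1) = 2 m = 0`.
    refine tate_zero_map_eq_zero _ fun m hm => ?_
    have h1 : MonoidAlgebra.of k _ (x : G ⧸ N) * (show k[G ⧸ N] from m) = m := by
      refine Eq.trans ?_ (hm x)
      refine congrArg (· * (show k[G ⧸ N] from m)) ?_
      simp [MonoidAlgebra.mapDomainRingHom_apply, MonoidAlgebra.mapDomain_single]
    have h2 := MonoidAlgebra.of_commute (R := k) (m := (x : G ⧸ N)) (fun g => by
      obtain ⟨g, rfl⟩ := QuotientGroup.mk_surjective g
      exact (hx g).symm) (show k[G ⧸ N] from m)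
    change (show k[G ⧸ N] from m) * (MonoidAlgebra.of k _ (x : G ⧸ N) + 1) = 0
    rw [mul_add, mul_one, ← h2.eq, h1]
    exact add_self_groupAlgebra _
  | succ n ih => exact (key _).1 ih
  | pred n ih =>
    refine (key _).2 ?_
    rw [sub_add_cancel]
    exact ih

end QuotientRegular

/-! ### The Klein four quotient -/

section Quaternion

variable {G : Type u} [Group G] (e : G ≃* QuaternionGroup 2)

theorem mem_normalClosure_quatE {g : G} (hg : g ∈ Subgroup.normalClosure {quatE e}) :
    g = 1 ∨ g = quatE e := by
  let C : Subgroup G :=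
    { carrier := {g | g = 1 ∨ g = quatE e}
      one_mem' := Or.inl rfl
      mul_mem' := by
        rintro _ _ (rfl | rfl) (rfl | rfl)
        · exact Or.inl (one_mul _)
        · exact Or.inr (one_mul _)
        · exact Or.inr (mul_one _)
        · exact Or.inl (quatE_mul_quatE e)
      inv_mem' := by
        rintro _ (rfl | rfl)
        · exact Or.inl inv_one
        · exact Or.inr (inv_eq_of_mul_eq_one_left (quatE_mul_quatE e)) }
  have : C.Normal := ⟨by
    rintro _ (rfl | rfl) g
    · exact Or.inl (by group)
    · exact Or.inr (by rw [quatE_comm, mul_inv_cancel_right])⟩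
  exact Subgroup.normalClosure_le_normal (N := C) (Set.singleton_subset_iff.2 (Or.inr rfl)) hg

theorem quatE_mem_normalClosure : quatE e ∈ Subgroup.normalClosure {quatE e} :=
  Subgroup.subset_normalClosure rfl

theorem quotient_comm (g h : G ⧸ Subgroup.normalClosure {quatE e}) : g * h = h * g := by
  obtain ⟨g, rfl⟩ := QuotientGroup.mk_surjective g
  obtain ⟨h, rfl⟩ := QuotientGroup.mk_surjective h
  rw [← QuotientGroup.mk_mul, ← QuotientGroup.mk_mul]
  obtain h | h := quat_comm_or e g h
  · rw [h]
  · rw [h, QuotientGroup.mk_mul_of_mem _ (quatE_mem_normalClosure e)]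

theorem quotient_mk_ne_one {g : QuaternionGroup 2} (h : g ≠ 1) (h' : g ≠ QuaternionGroup.a 2) :
    ((e.symm g : G) : G ⧸ Subgroup.normalClosure {quatE e}) ≠ 1 := by
  rw [Ne, QuotientGroup.eq_one_iff]
  intro hg
  obtain hg | hg := mem_normalClosure_quatE e hg
  · exact h (e.symm.injective (hg.trans (map_one _).symm))
  · exact h' (e.symm.injective (hg.trans (quatE_eq e)))

theorem one_add_mul_one_add_ne_zero (k : Type u) [Field k] :
    (MonoidAlgebra.of k _ ((quatI e : G) : G ⧸ Subgroup.normalClosure {quatE e}) + 1) *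
      (MonoidAlgebra.of k _ ((quatJ e : G) : G ⧸ Subgroup.normalClosure {quatE e}) + 1) ≠ 0 := by
  classical
  intro h
  have hi := quotient_mk_ne_one e (g := QuaternionGroup.a 1) (by decide) (by decide)
  have hj := quotient_mk_ne_one e (g := QuaternionGroup.xa 0) (by decide) (by decide)
  have hij := quotient_mk_ne_one e (g := QuaternionGroup.a 1 * QuaternionGroup.xa 0)
    (by decide) (by decide)
  rw [map_mul, QuotientGroup.mk_mul] at hij
  rw [add_mul, mul_add, ← map_mul, one_mul, mul_one, MonoidAlgebra.one_def] at h
  -- Of the four terms `ij`, `i`, `j`, `1` only the last contributes at the identity, because the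
  -- other three are nontrivial in the quotient.
  have h1 := congrArg (fun r => r.coeff 1) h
  simp only [MonoidAlgebra.of_apply, MonoidAlgebra.coeff_add, MonoidAlgebra.coeff_single,
    Finsupp.add_apply, Finsupp.single_apply, if_neg hi, if_neg hj, if_neg hij] at h1
  simp at h1

end Quaternion

theorem rightMul_mul {k G : Type u} [Field k] [Group G] (N : Subgroup G) [N.Normal]
    (v w : k[G ⧸ N]) : rightMul k N (v * w) = rightMul k N v ≫ rightMul k N w := by
  ext x
  exact (mul_assoc (show k[G ⧸ N] from x) v w).symm

theorem GhostPower.source_target {k G : Type u} [Field k] [Group G] [Fintype G]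
    {S : ObjectProperty (StMod k G)} {n : ℕ} {X Y : StMod k G} {f : X ⟶ Y}
    (h : GhostPower S n f) : S X ∧ S Y := by
  induction h with
  | zero hX hY f => exact ⟨hX, hY⟩
  | succ hX f g hf hg ih => exact ⟨hX, ih.2⟩

/-- The last ghost is absorbed into the arbitrary final map. Thus one nonzero double ghost rules out
every length below `3` at once. -/
theorem GhostPower.of_succ {k G : Type u} [Field k] [Group G] [Fintype G]
    {S : ObjectProperty (StMod k G)} {n : ℕ} : ∀ {X Y : StMod k G} {f : X ⟶ Y},
    GhostPower S (n + 1) f → GhostPower S n f := by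
  induction n with
  | zero => exact fun h => .zero h.source_target.1 h.source_target.2 _
  | succ n ih =>
    rintro _ _ _ (_ | ⟨hX, f, g, hf, hg⟩)
    exact .succ hX f g hf (ih hg)

/-! ### The double ghost and the lower bound -/

section GhostNumber

variable {k G : Type u} [Field k] [CharP k 2] [Group G] [Fintype G] (e : G ≃* QuaternionGroup 2)

theorem isGhost_rightMul (x : G) : IsGhost ((toStMod k G).map
    (rightMul k (Subgroup.normalClosure {quatE e}) (MonoidAlgebra.of k _ (x : G ⧸ _) + 1))) :=
  moduleTate_rightMul_eq_zero (quatE_mul_quatE e) (quatE_ne_one e) (quatE_mem_normalClosure e)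
    (fun _ => mem_normalClosure_quatE e) (quatE_comm e) x fun _ => quotient_comm e _ _

theorem ghostPower_rightMul {S : ObjectProperty (StMod k G)}
    (hS : S ((toStMod k G).obj (quotientRegular k (Subgroup.normalClosure {quatE e})))) (x y : G) :
    GhostPower S 2 ((toStMod k G).map (rightMul k (Subgroup.normalClosure {quatE e})
      ((MonoidAlgebra.of k _ (x : G ⧸ _) + 1) * (MonoidAlgebra.of k _ (y : G ⧸ _) + 1)))) := by
  have := GhostPower.succ hS _ _ (isGhost_rightMul e x)
    (.succ hS _ _ (isGhost_rightMul e y) (.zero hS hS (𝟙 _)))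
  rwa [Category.comp_id, ← Functor.map_comp, ← rightMul_mul] at this

theorem rightMul_ne_zero : (toStMod k G).map (rightMul k (Subgroup.normalClosure {quatE e})
      ((MonoidAlgebra.of k _ ((quatI e : G) : G ⧸ _) + 1) *
        (MonoidAlgebra.of k _ ((quatJ e : G) : G ⧸ _) + 1))) ≠ 0 := by
  rw [Ne, toStMod_map_eq_zero_iff]
  exact fun h => one_add_mul_one_add_ne_zero e k (rightMul_eq_zero_of_stablyTrivial
    (quatE_mul_quatE e) (quatE_ne_one e) (quatE_mem_normalClosure e) (quatE_comm e) h)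

open ModuleCat in
theorem thickTrivial_quotientRegular : thickTrivial k G
    ((toStMod k G).obj (quotientRegular k (Subgroup.normalClosure {quatE e}))) := by
  have := finite_quotientRegular (k := k) (N := Subgroup.normalClosure {quatE e})
  have : Module.Finite k (quotientRegular k (Subgroup.normalClosure {quatE e})) :=
    Module.Finite.trans k[G] _
  exact thickTrivial_of_finite e _ 4 (isKilled_four e fun v => normElement_smul_quotientRegular
    (quatE_mul_quatE e) (quatE_ne_one e) (quatE_mem_normalClosure e) v)

include e in
theorem three_le_ghostNumber : 3 ≤ ghostNumber k G := by
  have hS := thickTrivial_quotientRegular (k := k) e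
  refine le_iSup₂_of_le _ hS (le_iInf₂ fun n hn => ?_)
  by_contra hlt
  have h2 := ghostPower_rightMul e hS (quatI e) (quatJ e)
  refine rightMul_ne_zero e (hn _ _ ?_)
  have hn3 : n < 3 := by
    rw [not_le] at hlt
    exact_mod_cast hlt
  interval_cases n
  · exact h2.of_succ.of_succ
  · exact h2.of_succ
  · exact h2

end GhostNumber

end StableModule

theorem mainTheorem9 {k G : Type u} [Field k] [CharP k 2] [Group G] [Fintype G]
    (e : G ≃* QuaternionGroup 2) (i j ε : G) (hi : i = e.symm (QuaternionGroup.a 1))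
    (hj : j = e.symm (QuaternionGroup.xa 0)) (hε : ε = i ^ 2) :
    (GhostPower (stmod k G) 2 ((toStMod k G).map
        (rightMul k (Subgroup.normalClosure {ε})
          ((MonoidAlgebra.of k _ (i : G ⧸ Subgroup.normalClosure {ε}) + 1) *
            (MonoidAlgebra.of k _ (j : G ⧸ Subgroup.normalClosure {ε}) + 1)))) ∧
      (toStMod k G).map
        (rightMul k (Subgroup.normalClosure {ε})
          ((MonoidAlgebra.of k _ (i : G ⧸ Subgroup.normalClosure {ε}) + 1) *
            (MonoidAlgebra.of k _ (j : G ⧸ Subgroup.normalClosure {ε}) + 1))) ≠ 0) ∧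
    3 ≤ ghostNumber k G ∧ ghostNumber k G ≤ generatingNumber k G ∧
      generatingNumber k G ≤ 4 := by
  subst hi hj hε
  exact ⟨⟨ghostPower_rightMul e ⟨_, finite_quotientRegular, ⟨Iso.refl _⟩⟩ _ _,
    rightMul_ne_zero e⟩, three_le_ghostNumber e, ghostNumber_le_generatingNumber,
    generatingNumber_le_four e⟩
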